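/- Let $R$ be a quasi-Frobenius ring, that is, a (not necessarily commutative) unital ring that is right artinian and injective as a right module over itself. Let $\mathcal{C}$ be an $R$-coring, i.e. a coalgebra in the monoidal category of $R$-bimodules, and assume that $\mathcal{C}$ is locally projective both as a left and as a right $R$-module; here a module $M$ is called locally projective if for every finite subset $F\subset M$ there are finitely many elements $x_1,\dots,x_n\in M$ and $R$-linear maps $f_1,\dots,f_n\colon M\to R$ such that, for left modules, $x=\sum_{k} f_k(x)x_k$ for all $x\in F$, and, for right modules, $x=\sum_k x_kf_k(x)$ for all $x\in F$. (In particular, every projective module is locally projective.) A projective cover of a $\mathcal{C}$-comodule $M$ is an epimorphism $f\colon P\to M$ in the category of (left, respectively right) $\mathcal{C}$-comodules such that $P$ is a projective object and $\ker f$ is small in $P$, i.e. $\ker f+L=P$ implies $L=P$ for every subcomodule $L\subset P$. Then the following assertions are equivalent: 1. $\mathcal{C}$ is left and right perfect, i.e. every left $\mathcal{C}$-comodule and every right $\mathcal{C}$-comodule has a projective cover; 2. $\mathcal{C}$ is left and right semiperfect, i.e. every simple left $\mathcal{C}$-comodule and every simple right $\mathcal{C}$-comodule has a projective cover. -/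

import Mathlib

open CategoryTheory
open scoped TensorProduct

universe u v w

/-! ### The tensor product over a noncommutative ring

A right `R`-module is a module over `Rᵐᵒᵖ`, so that `m r` is `MulOpposite.op r • m`; an
`R`-bimodule carries commuting actions of `R` and `Rᵐᵒᵖ`. -/

/-- The relations `m r ⊗ n = m ⊗ r n`. -/
def BalTensor.relations (R : Type u) (M : Type v) (N : Type w) [Ring R]
    [AddCommGroup M] [Module Rᵐᵒᵖ M] [AddCommGroup N] [Module R N] :
    AddSubgroup (M ⊗[ℤ] N) :=
  AddSubgroup.closure
    {t | ∃ (m : M) (r : R) (n : N),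
      t = (MulOpposite.op r • m) ⊗ₜ[ℤ] n - m ⊗ₜ[ℤ] (r • n)}

/-- `M ⊗_R N` for a right `R`-module `M` and a left `R`-module `N` over an arbitrary ring `R`: the
quotient of `M ⊗_ℤ N` by the relations `m r ⊗ n = m ⊗ r n`. -/
def BalTensor (R : Type u) (M : Type v) (N : Type w) [Ring R]
    [AddCommGroup M] [Module Rᵐᵒᵖ M] [AddCommGroup N] [Module R N] : Type (max v w) :=
  (M ⊗[ℤ] N) ⧸ BalTensor.relations R M N

namespace BalTensor

section basic

variable (R : Type u) {M : Type v} {N : Type w} [Ring R]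
  [AddCommGroup M] [Module Rᵐᵒᵖ M] [AddCommGroup N] [Module R N]

instance instAddCommGroup : AddCommGroup (BalTensor R M N) :=
  inferInstanceAs (AddCommGroup ((M ⊗[ℤ] N) ⧸ BalTensor.relations R M N))

/-- The pure tensor `m ⊗ n` in `M ⊗_R N`. -/
def tmul (m : M) (n : N) : BalTensor R M N :=
  QuotientAddGroup.mk' (BalTensor.relations R M N) (m ⊗ₜ[ℤ] n)

theorem add_tmul (m m' : M) (n : N) : tmul R (m + m') n = tmul R m n + tmul R m' n := by
  simp only [tmul, TensorProduct.add_tmul, map_add]; rfl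

theorem tmul_add (m : M) (n n' : N) : tmul R m (n + n') = tmul R m n + tmul R m n' := by
  simp only [tmul, TensorProduct.tmul_add, map_add]; rfl

theorem op_smul_tmul (r : R) (m : M) (n : N) :
    tmul R (MulOpposite.op r • m) n = tmul R m (r • n) := by
  refine (QuotientAddGroup.eq_iff_sub_mem).2 ?_
  exact AddSubgroup.subset_closure ⟨m, r, n, rfl⟩

/-- The universal property: a biadditive map `f` with `f (m r) n = f m (r n)` factors through
`M ⊗_R N`. -/
def lift {P : Type*} [AddCommGroup P] (f : M →+ N →+ P)
    (hf : ∀ (r : R) (m : M) (n : N), f (MulOpposite.op r • m) n = f m (r • n)) :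
    BalTensor R M N →+ P :=
  QuotientAddGroup.lift (BalTensor.relations R M N)
    (TensorProduct.liftAddHom f (fun z m n => by simp))
    (by
      rw [BalTensor.relations, AddSubgroup.closure_le]
      rintro _ ⟨m, r, n, rfl⟩
      simp [hf])

@[simp]
theorem lift_tmul {P : Type*} [AddCommGroup P] (f : M →+ N →+ P)
    (hf : ∀ (r : R) (m : M) (n : N), f (MulOpposite.op r • m) n = f m (r • n)) (m : M) (n : N) :
    lift R f hf (tmul R m n) = f m n := rfl

theorem hom_ext {P : Type*} [AddCommGroup P] {f g : BalTensor R M N →+ P}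
    (h : ∀ m n, f (tmul R m n) = g (tmul R m n)) : f = g := by
  refine QuotientAddGroup.addMonoidHom_ext _ ?_
  ext t
  induction t using TensorProduct.induction_on with
  | zero => simp
  | tmul m n => exact h m n
  | add x y hx hy => rw [map_add, map_add, hx, hy]

/-- `(f, g) ↦ f ⊗ g` for additive maps `f`, `g` for which this respects the relations. -/
def mapAdd {M' : Type*} {N' : Type*} [AddCommGroup M'] [Module Rᵐᵒᵖ M'] [AddCommGroup N']
    [Module R N'] (f : M →+ M') (g : N →+ N')
    (h : ∀ (r : R) (m : M) (n : N),
      tmul R (f (MulOpposite.op r • m)) (g n) = tmul R (f m) (g (r • n))) :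
    BalTensor R M N →+ BalTensor R M' N' :=
  lift R
    (AddMonoidHom.mk' (fun m => AddMonoidHom.mk' (fun n => tmul R (f m) (g n))
        (fun n n' => by rw [map_add, tmul_add]))
      (fun m m' => by ext n; simp [add_tmul]))
    h

/-- The map `f ⊗_R g`, for `f` right `R`-linear and `g` left `R`-linear. -/
def map {M' : Type*} {N' : Type*} [AddCommGroup M'] [Module Rᵐᵒᵖ M'] [AddCommGroup N']
    [Module R N'] (f : M →ₗ[Rᵐᵒᵖ] M') (g : N →ₗ[R] N') : BalTensor R M N →+ BalTensor R M' N' :=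
  mapAdd R f.toAddMonoidHom g.toAddMonoidHom (fun r m n => by simp [op_smul_tmul])

@[simp]
theorem map_tmul {M' : Type*} {N' : Type*} [AddCommGroup M'] [Module Rᵐᵒᵖ M'] [AddCommGroup N']
    [Module R N'] (f : M →ₗ[Rᵐᵒᵖ] M') (g : N →ₗ[R] N') (m : M) (n : N) :
    map R f g (tmul R m n) = tmul R (f m) (g n) := rfl

/-- If `M` is an `R`-bimodule, then `M ⊗_R N` is a left `R`-module through `r (m ⊗ n) = r m ⊗ n`. -/
instance instModuleLeft [Module R M] [SMulCommClass R Rᵐᵒᵖ M] : Module R (BalTensor R M N) :=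
  Module.compHom (BalTensor R M N)
    ({ toFun := fun r => mapAdd R (DistribSMul.toAddMonoidHom M r) (AddMonoidHom.id N)
        (fun s m n => by simp [smul_comm r (MulOpposite.op s) m, op_smul_tmul])
       map_one' := hom_ext R (fun m n => by simp [mapAdd]; rfl)
       map_mul' := fun r s => hom_ext R (fun m n => by simp [mapAdd, mul_smul]; rfl)
       map_zero' := hom_ext R (fun m n => by
        have h := add_tmul R (0 : M) 0 n
        simp [mapAdd] at h ⊢
        exact h)
       map_add' := fun r s => hom_ext R (fun m n => by
        simp [mapAdd, add_smul, add_tmul]; rfl) } : R →+* AddMonoid.End (BalTensor R M N))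

theorem smul_tmul [Module R M] [SMulCommClass R Rᵐᵒᵖ M] (r : R) (m : M) (n : N) :
    r • tmul R m n = tmul R (r • m) n := rfl

/-- If `N` is an `R`-bimodule, then `M ⊗_R N` is a right `R`-module through
`(m ⊗ n) r = m ⊗ n r`. -/
instance instModuleRight [Module Rᵐᵒᵖ N] [SMulCommClass R Rᵐᵒᵖ N] :
    Module Rᵐᵒᵖ (BalTensor R M N) :=
  Module.compHom (BalTensor R M N)
    ({ toFun := fun r => mapAdd R (AddMonoidHom.id M) (DistribSMul.toAddMonoidHom N r)
        (fun s m n => by simp [← smul_comm s r n, op_smul_tmul])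
       map_one' := hom_ext R (fun m n => by simp [mapAdd]; rfl)
       map_mul' := fun r s => hom_ext R (fun m n => by simp [mapAdd, mul_smul]; rfl)
       map_zero' := hom_ext R (fun m n => by
        have h := tmul_add R m (0 : N) 0
        simp [mapAdd] at h ⊢
        exact h)
       map_add' := fun r s => hom_ext R (fun m n => by
        simp [mapAdd, add_smul, tmul_add]; rfl) } : Rᵐᵒᵖ →+* AddMonoid.End (BalTensor R M N))

theorem op_smul_tmul_right [Module Rᵐᵒᵖ N] [SMulCommClass R Rᵐᵒᵖ N] (r : Rᵐᵒᵖ) (m : M) (n : N) :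
    r • tmul R m n = tmul R m (r • n) := rfl

/-- The canonical map `R ⊗_R N → N`, `r ⊗ n ↦ r n`. -/
def lid (N : Type w) [AddCommGroup N] [Module R N] : BalTensor R R N →+ N :=
  lift R
    (AddMonoidHom.mk' (fun r => DistribSMul.toAddMonoidHom N r)
      (fun r s => by ext n; simp [add_smul]))
    (fun r s n => by simp [mul_smul])

/-- The canonical map `M ⊗_R R → M`, `m ⊗ r ↦ m r`. -/
def rid (M : Type v) [AddCommGroup M] [Module Rᵐᵒᵖ M] : BalTensor R M R →+ M :=
  lift R
    (AddMonoidHom.mk'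
      (fun m => AddMonoidHom.mk' (fun r : R => MulOpposite.op r • m)
        (fun r s => by simp [add_smul]))
      (fun m m' => by ext r; simp))
    (fun r m s => by simp [mul_smul])

end basic

/-- For fixed `p`, the map `M ⊗_R N → M ⊗_R (N ⊗_R P)`, `m ⊗ n ↦ m ⊗ (n ⊗ p)`. -/
def assocAux (R : Type u) [Ring R] (M N : Type*) {P : Type*} [AddCommGroup M] [Module Rᵐᵒᵖ M]
    [AddCommGroup N] [Module R N] [Module Rᵐᵒᵖ N] [SMulCommClass R Rᵐᵒᵖ N]
    [AddCommGroup P] [Module R P] (p : P) :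
    BalTensor R M N →+ BalTensor R M (BalTensor R N P) :=
  lift R
    (AddMonoidHom.mk'
      (fun m : M => AddMonoidHom.mk' (fun n : N => tmul R m (tmul R n p))
        (fun n n' => by rw [add_tmul, tmul_add]))
      (fun m m' => by ext n; simp [add_tmul]))
    (fun r m n => by simp [op_smul_tmul, smul_tmul])

/-- The associativity map `(M ⊗_R N) ⊗_R P → M ⊗_R (N ⊗_R P)`, `(m ⊗ n) ⊗ p ↦ m ⊗ (n ⊗ p)`, for
an `R`-bimodule `N`. -/
def assoc (R : Type u) [Ring R] (M N P : Type*) [AddCommGroup M] [Module Rᵐᵒᵖ M]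
    [AddCommGroup N] [Module R N] [Module Rᵐᵒᵖ N] [SMulCommClass R Rᵐᵒᵖ N]
    [AddCommGroup P] [Module R P] :
    BalTensor R (BalTensor R M N) P →+ BalTensor R M (BalTensor R N P) :=
  lift R
    (AddMonoidHom.flip (AddMonoidHom.mk' (fun p : P => assocAux R M N p)
      (fun p p' => hom_ext R (fun m n => by simp [assocAux, tmul_add]))))
    (fun r t p => by
      have h : (assocAux R M N p).comp
          (DistribSMul.toAddMonoidHom (BalTensor R M N) (MulOpposite.op r)) =
          assocAux R M N (r • p) :=
        hom_ext R (fun m n => by simp [assocAux, op_smul_tmul_right, op_smul_tmul])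
      exact DFunLike.congr_fun h t)

@[simp]
theorem assoc_tmul (R : Type u) [Ring R] {M N P : Type*} [AddCommGroup M] [Module Rᵐᵒᵖ M]
    [AddCommGroup N] [Module R N] [Module Rᵐᵒᵖ N] [SMulCommClass R Rᵐᵒᵖ N]
    [AddCommGroup P] [Module R P] (m : M) (n : N) (p : P) :
    assoc R M N P (tmul R (tmul R m n) p) = tmul R m (tmul R n p) := rfl

end BalTensor

/-! ### Corings and their comodules -/

/-- The structure maps of an `R`-coring on an `R`-bimodule `C`: bimodule maps `Δ : C → C ⊗_R C` and
`ε : C → R`. -/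
class CoringStruct (R C : Type u) [Ring R] [AddCommGroup C] [Module R C] [Module Rᵐᵒᵖ C]
    [SMulCommClass R Rᵐᵒᵖ C] where
  /-- the comultiplication as a left linear map -/
  comulL : C →ₗ[R] BalTensor R C C
  comulL_op_smul : ∀ (r : Rᵐᵒᵖ) (c : C), comulL (r • c) = r • comulL c
  /-- the counit as a left linear map -/
  counitL : C →ₗ[R] R
  counitL_op_smul : ∀ (r : Rᵐᵒᵖ) (c : C), counitL (r • c) = r • counitL c

namespace CoringStruct

variable (R C : Type u) [Ring R] [AddCommGroup C] [Module R C] [Module Rᵐᵒᵖ C]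
  [SMulCommClass R Rᵐᵒᵖ C] [CoringStruct R C]

/-- The comultiplication as a right linear map. -/
def comulR : C →ₗ[Rᵐᵒᵖ] BalTensor R C C where
  toFun := comulL (R := R)
  map_add' := map_add _
  map_smul' := comulL_op_smul

/-- The counit as a right linear map. -/
def counitR : C →ₗ[Rᵐᵒᵖ] R where
  toFun := counitL (R := R)
  map_add' := map_add _
  map_smul' := counitL_op_smul

end CoringStruct

open CoringStruct in
/-- An `R`-coring: a coalgebra in the monoidal category of `R`-bimodules. -/
class Coring (R C : Type u) [Ring R] [AddCommGroup C] [Module R C] [Module Rᵐᵒᵖ C]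
    [SMulCommClass R Rᵐᵒᵖ C] extends CoringStruct R C where
  coassoc : ∀ c : C,
    BalTensor.assoc R C C C (BalTensor.map R (comulR R C) LinearMap.id (comulL c)) =
      BalTensor.map R LinearMap.id comulL (comulL c)
  counit_comul : ∀ c : C,
    BalTensor.lid R C (BalTensor.map R (counitR R C) LinearMap.id (comulL c)) = c
  comul_counit : ∀ c : C,
    BalTensor.rid R C (BalTensor.map R LinearMap.id counitL (comulL c)) = c

section comodules

variable (R C : Type u) [Ring R] [AddCommGroup C] [Module R C] [Module Rᵐᵒᵖ C]
  [SMulCommClass R Rᵐᵒᵖ C] [Coring R C]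

/-- A right `C`-comodule: a right `R`-module `M` with a coassociative and counital right `R`-linear
coaction `ρ : M → M ⊗_R C`. -/
structure RightComod where
  carrier : Type u
  [addCommGroup : AddCommGroup carrier]
  [module : Module Rᵐᵒᵖ carrier]
  coact : carrier →ₗ[Rᵐᵒᵖ] BalTensor R carrier C
  coassoc : ∀ m : carrier,
    BalTensor.assoc R carrier C C (BalTensor.map R coact LinearMap.id (coact m)) =
      BalTensor.map R LinearMap.id CoringStruct.comulL (coact m)
  counit : ∀ m : carrier,
    BalTensor.rid R carrier (BalTensor.map R LinearMap.id CoringStruct.counitL (coact m)) = m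

/-- A left `C`-comodule: a left `R`-module `M` with a coassociative and counital left `R`-linear
coaction `ρ : M → C ⊗_R M`. -/
structure LeftComod where
  carrier : Type u
  [addCommGroup : AddCommGroup carrier]
  [module : Module R carrier]
  coact : carrier →ₗ[R] BalTensor R C carrier
  coassoc : ∀ m : carrier,
    BalTensor.assoc R C C carrier
        (BalTensor.map R (CoringStruct.comulR R C) LinearMap.id (coact m)) =
      BalTensor.map R LinearMap.id coact (coact m)
  counit : ∀ m : carrier,
    BalTensor.lid R carrier
      (BalTensor.map R (CoringStruct.counitR R C) LinearMap.id (coact m)) = m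

attribute [instance] RightComod.addCommGroup RightComod.module
attribute [instance] LeftComod.addCommGroup LeftComod.module

variable {R C}

namespace RightComod

/-- `C`-colinear maps of right comodules. -/
@[ext]
structure Hom (M N : RightComod R C) where
  lin : M.carrier →ₗ[Rᵐᵒᵖ] N.carrier
  colinear : ∀ m : M.carrier,
    N.coact (lin m) = BalTensor.map R lin LinearMap.id (M.coact m)

/-- The category of right `C`-comodules. -/
instance instCategory : Category (RightComod R C) where
  Hom M N := Hom M N
  id M :=
    { lin := LinearMap.id
      colinear := fun m => by
        have h : BalTensor.map R (LinearMap.id : M.carrier →ₗ[Rᵐᵒᵖ] M.carrier)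
            (LinearMap.id : C →ₗ[R] C) = AddMonoidHom.id _ :=
          BalTensor.hom_ext R (fun _ _ => rfl)
        rw [h]; rfl }
  comp {M N P} f g :=
    { lin := g.lin.comp f.lin
      colinear := fun m => by
        have h : BalTensor.map R (g.lin.comp f.lin) (LinearMap.id : C →ₗ[R] C) =
            (BalTensor.map R g.lin LinearMap.id).comp (BalTensor.map R f.lin LinearMap.id) :=
          BalTensor.hom_ext R (fun _ _ => rfl)
        rw [h, AddMonoidHom.comp_apply, ← f.colinear, ← g.colinear]; rfl }

instance instHasZeroMorphisms : Limits.HasZeroMorphisms (RightComod R C) where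
  zero M N := ⟨
    { lin := 0
      colinear := fun m => by
        have h : BalTensor.map R (0 : M.carrier →ₗ[Rᵐᵒᵖ] N.carrier)
            (LinearMap.id : C →ₗ[R] C) = 0 :=
          BalTensor.hom_ext R (fun m c => by
            have h := BalTensor.add_tmul R (0 : N.carrier) 0 c
            simpa using h)
        rw [h]; simp }⟩
  comp_zero {M N} f P := Hom.ext (LinearMap.zero_comp f.lin)
  zero_comp M {N P} f := Hom.ext (LinearMap.comp_zero f.lin)

/-- A subcomodule of `M`: an `R`-submodule `L` such that `ρ` maps `L` to the image of `L ⊗_R C` in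
`M ⊗_R C`. -/
def IsSubcomodule (M : RightComod R C) (L : Submodule Rᵐᵒᵖ M.carrier) : Prop :=
  ∀ m ∈ L, M.coact m ∈
    (BalTensor.map R L.subtype (LinearMap.id : C →ₗ[R] C)).range

/-- `K` is small (superfluous) in `M`: `K + L = M` implies `L = M`, for all subcomodules `L`. -/
def IsSmall (M : RightComod R C) (K : Submodule Rᵐᵒᵖ M.carrier) : Prop :=
  ∀ L : Submodule Rᵐᵒᵖ M.carrier, M.IsSubcomodule L → K ⊔ L = ⊤ → L = ⊤

/-- `f : P ⟶ M` is a projective cover of `M`: `P` is a projective object and `f` is an epimorphism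
with small kernel. -/
def IsProjectiveCover {P M : RightComod R C} (f : P ⟶ M) : Prop :=
  Projective P ∧ Epi f ∧ P.IsSmall (LinearMap.ker (Hom.lin f))

/-- `M` has a projective cover. -/
def HasProjectiveCover (M : RightComod R C) : Prop :=
  ∃ (P : RightComod R C) (f : P ⟶ M), IsProjectiveCover f

end RightComod

namespace LeftComod

/-- `C`-colinear maps of left comodules. -/
@[ext]
structure Hom (M N : LeftComod R C) where
  lin : M.carrier →ₗ[R] N.carrier
  colinear : ∀ m : M.carrier,
    N.coact (lin m) = BalTensor.map R LinearMap.id lin (M.coact m)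

/-- The category of left `C`-comodules. -/
instance instCategory : Category (LeftComod R C) where
  Hom M N := Hom M N
  id M :=
    { lin := LinearMap.id
      colinear := fun m => by
        have h : BalTensor.map R (LinearMap.id : C →ₗ[Rᵐᵒᵖ] C)
            (LinearMap.id : M.carrier →ₗ[R] M.carrier) = AddMonoidHom.id _ :=
          BalTensor.hom_ext R (fun _ _ => rfl)
        rw [h]; rfl }
  comp {M N P} f g :=
    { lin := g.lin.comp f.lin
      colinear := fun m => by
        have h : BalTensor.map R (LinearMap.id : C →ₗ[Rᵐᵒᵖ] C) (g.lin.comp f.lin) =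
            (BalTensor.map R LinearMap.id g.lin).comp (BalTensor.map R LinearMap.id f.lin) :=
          BalTensor.hom_ext R (fun _ _ => rfl)
        rw [h, AddMonoidHom.comp_apply, ← f.colinear, ← g.colinear]; rfl }

instance instHasZeroMorphisms : Limits.HasZeroMorphisms (LeftComod R C) where
  zero M N := ⟨
    { lin := 0
      colinear := fun m => by
        have h : BalTensor.map R (LinearMap.id : C →ₗ[Rᵐᵒᵖ] C)
            (0 : M.carrier →ₗ[R] N.carrier) = 0 :=
          BalTensor.hom_ext R (fun c m => by
            have h := BalTensor.tmul_add R c (0 : N.carrier) 0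
            simpa using h)
        rw [h]; simp }⟩
  comp_zero {M N} f P := Hom.ext (LinearMap.zero_comp f.lin)
  zero_comp M {N P} f := Hom.ext (LinearMap.comp_zero f.lin)

/-- A subcomodule of `M`: an `R`-submodule `L` such that `ρ` maps `L` to the image of `C ⊗_R L` in
`C ⊗_R M`. -/
def IsSubcomodule (M : LeftComod R C) (L : Submodule R M.carrier) : Prop :=
  ∀ m ∈ L, M.coact m ∈
    (BalTensor.map R (LinearMap.id : C →ₗ[Rᵐᵒᵖ] C) L.subtype).range

/-- `K` is small (superfluous) in `M`: `K + L = M` implies `L = M`, for all subcomodules `L`. -/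
def IsSmall (M : LeftComod R C) (K : Submodule R M.carrier) : Prop :=
  ∀ L : Submodule R M.carrier, M.IsSubcomodule L → K ⊔ L = ⊤ → L = ⊤

/-- `f : P ⟶ M` is a projective cover of `M`: `P` is a projective object and `f` is an epimorphism
with small kernel. -/
def IsProjectiveCover {P M : LeftComod R C} (f : P ⟶ M) : Prop :=
  Projective P ∧ Epi f ∧ P.IsSmall (LinearMap.ker (Hom.lin f))

/-- `M` has a projective cover. -/
def HasProjectiveCover (M : LeftComod R C) : Prop :=
  ∃ (P : LeftComod R C) (f : P ⟶ M), IsProjectiveCover f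

end LeftComod

variable (R C)

/-- `C` is right perfect: every right `C`-comodule has a projective cover. -/
def IsRightPerfectCoring : Prop := ∀ M : RightComod R C, M.HasProjectiveCover

/-- `C` is left perfect: every left `C`-comodule has a projective cover. -/
def IsLeftPerfectCoring : Prop := ∀ M : LeftComod R C, M.HasProjectiveCover

/-- `C` is right semiperfect: every simple right `C`-comodule has a projective cover. -/
def IsRightSemiperfectCoring : Prop := ∀ M : RightComod R C, Simple M → M.HasProjectiveCover

/-- `C` is left semiperfect: every simple left `C`-comodule has a projective cover. -/
def IsLeftSemiperfectCoring : Prop := ∀ M : LeftComod R C, Simple M → M.HasProjectiveCover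

end comodules

/-! ### Conditions on the base ring and on the underlying modules -/

/-- A quasi-Frobenius ring: right artinian and injective as a right module over itself. -/
structure IsQFRing (R : Type u) [Ring R] : Prop where
  artinian : IsArtinian Rᵐᵒᵖ R
  injective : Module.Injective Rᵐᵒᵖ R

/-- A module is locally projective if each finite set of its elements has a finite dual basis: there
are `x_1, …, x_n` in `M` and linear forms `f_1, …, f_n` with `x = ∑ f_k(x) x_k` for all `x` in the
finite set. Every projective module is locally projective. For right modules take `A = Rᵐᵒᵖ`. -/
def IsLocallyProjective (A : Type u) (M : Type v) [Ring A] [AddCommGroup M] [Module A M] : Prop :=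
  ∀ F : Finset M, ∃ (n : ℕ) (x : Fin n → M) (f : Fin n → (M →ₗ[A] A)),
    ∀ m ∈ F, m = ∑ k, f k m • x k

/-! ### Injective modules and separation by linear forms -/

section generalities

variable {Λ : Type u} [Ring Λ]

/-! Only the passage from semiperfect to perfect needs an argument; the converse is restriction to
simple comodules.

Local projectivity turns comodules into modules. The left colinear endomorphisms of `C` form a ring
`A`, identified with the left dual of `C` by `θ ↦ ε ∘ θ`, and right comodules amount to rational
`A`-modules: those in which `a ↦ a y` comes from a finite sum of tensors `y' ⊗ c`. Left comodules
are likewise rational modules over the ring `B` of right colinear endomorphisms. Rational modules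
are closed under submodules, quotients and direct sums, and a cyclic one is finitely generated over
`R` (`RationalData.IsRational.baseFinite`), hence of finite length, since a quasi-Frobenius ring is
artinian and noetherian on both sides. On either side `C` is an injective cogenerator for the
rational modules: linear maps to `C` correspond to `R`-linear forms, and `R` is an injective
cogenerator on both sides.

Semiperfectness on the opposite side enters through the duality `Hom(-, C)`. It takes modules finite
over `R` to rational ones (`RationalData.BaseFinite.isRational_dual`), so the dual of a projective
is injective (`RationalData.isClassInjective_dual`). The projective cover of a simple `B`-module is
cyclic, so its dual is moreover noetherian, and every simple rational `A`-module embeds in such a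
dual (`RationalData.exists_injective_embedding`). Hence every nonzero rational `A`-module maps
nontrivially to a noetherian one and has a maximal submodule; so radicals are superfluous.

Semiperfectness on the same side then finishes as in Bass's theory of perfect rings
(`IsLocallyFiniteClass.hasClassCover`). Covers of simples show that `M / rad M` is semisimple; the
direct sum of the covers of its simple summands lifts to `M`, and superfluity of the radicals makes
the lift a projective cover. -/

theorem Module.Injective.exists_comp_eq_of_ker_le {U M N : Type u} [AddCommGroup U] [Module Λ U]
    [AddCommGroup M] [Module Λ M] [AddCommGroup N] [Module Λ N] (hU : Module.Injective Λ U)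
    (v : M →ₗ[Λ] N) (f : M →ₗ[Λ] U) (h : LinearMap.ker v ≤ LinearMap.ker f) :
    ∃ g : N →ₗ[Λ] U, ∀ m, g (v m) = f m := by
  obtain ⟨g, hg⟩ := hU.out (LinearMap.range v).subtype (Submodule.injective_subtype _)
    ((LinearMap.ker v).liftQ f h ∘ₗ v.quotKerEquivRange.symm.toLinearMap)
  refine ⟨g, fun m => ?_⟩
  have h1 := hg ⟨v m, LinearMap.mem_range_self v m⟩
  have h2 : v.quotKerEquivRange.symm ⟨v m, LinearMap.mem_range_self v m⟩ =
      (LinearMap.ker v).mkQ m := by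
    rw [LinearEquiv.symm_apply_eq]; rfl
  simpa [h2] using h1

/-- An injective module receiving a nonzero map from each simple module is a cogenerator. -/
theorem Module.Injective.exists_apply_ne_zero {U Z : Type u} [AddCommGroup U] [Module Λ U]
    [AddCommGroup Z] [Module Λ Z] (hU : Module.Injective Λ U)
    (hK : ∀ (W : Type u) [AddCommGroup W] [Module Λ W] [IsSimpleModule Λ W],
      ∃ f : W →ₗ[Λ] U, f ≠ 0) {z : Z} (hz : z ≠ 0) :
    ∃ g : Z →ₗ[Λ] U, g z ≠ 0 := by
  let N := Submodule.span Λ {z}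
  have : Nontrivial N := Submodule.nontrivial_iff_ne_bot.2 (by simpa [N] using hz)
  have : Module.Finite Λ N := Module.Finite.iff_fg.2 ⟨{z}, by simp [N]⟩
  obtain ⟨K, hK', -⟩ := (eq_top_or_exists_le_coatom (⊥ : Submodule Λ N)).resolve_left bot_ne_top
  have := isSimpleModule_iff_isCoatom.2 hK'
  obtain ⟨f, hf⟩ := hK (N ⧸ K)
  obtain ⟨g, hg⟩ := hU.out N.subtype (Submodule.injective_subtype _) (f ∘ₗ K.mkQ)
  refine ⟨g, fun h0 => hf ?_⟩
  have hN : N ≤ LinearMap.ker g := by simpa [N, Submodule.span_le] using h0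
  refine LinearMap.ext fun x => ?_
  obtain ⟨y, rfl⟩ := K.mkQ_surjective x
  have := hg y
  simp only [LinearMap.comp_apply] at this
  rw [← this]
  exact hN y.2

/-- Over an artinian ring a simple module is determined by its annihilator. -/
theorem IsSimpleModule.nonempty_linearEquiv_of_annihilator_le [IsArtinianRing Λ] {V W : Type*}
    [AddCommGroup V] [Module Λ V] [AddCommGroup W] [Module Λ W] [IsSimpleModule Λ V]
    [IsSimpleModule Λ W] (h : ∀ r : Λ, (∀ v : V, r • v = 0) → ∀ w : W, r • w = 0) :
    Nonempty (V ≃ₗ[Λ] W) := by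
  -- By the descending chain condition the annihilator of `V` is that of a finite subset `s`, so `Λ
  -- / ann V` embeds in the semisimple module `V^s`.
  obtain ⟨s, hs⟩ := Finset.exists_inf_le (fun v : V => LinearMap.ker (LinearMap.toSpanSingleton Λ V v))
  have := IsSimpleModule.nontrivial Λ W
  obtain ⟨w, hw⟩ := exists_ne (0 : W)
  let v : Λ →ₗ[Λ] (s → V) := LinearMap.pi fun i => LinearMap.toSpanSingleton Λ V i
  let f := LinearMap.toSpanSingleton Λ W w
  have hle : LinearMap.ker v ≤ LinearMap.ker f := by
    intro r hr
    have hr' : ∀ i ∈ s, r • i = 0 := fun i hi => congrFun (LinearMap.mem_ker.1 hr) ⟨i, hi⟩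
    refine h r (fun x => ?_) w
    refine hs x ?_
    rw [Finset.inf_eq_iInf]
    simpa using hr'
  let f' : LinearMap.range v →ₗ[Λ] W :=
    (LinearMap.ker v).liftQ f hle ∘ₗ v.quotKerEquivRange.symm.toLinearMap
  have hf' : f' ≠ 0 := by
    intro h0
    have h2 : v.quotKerEquivRange.symm ⟨v 1, LinearMap.mem_range_self v 1⟩ =
        (LinearMap.ker v).mkQ 1 := by
      rw [LinearEquiv.symm_apply_eq]; rfl
    have := LinearMap.congr_fun h0 ⟨v 1, LinearMap.mem_range_self v 1⟩
    simp [f', h2, f] at this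
    exact hw this
  -- The simple quotient `W` of the semisimple module `range v` is also a submodule of it; some
  -- coordinate of `W → V^s` is then a nonzero map between simple modules.
  obtain ⟨S, ⟨e⟩⟩ := LinearMap.linearEquiv_of_ne_zero hf'
  let i : W →ₗ[Λ] (s → V) := (LinearMap.range v).subtype ∘ₗ S.subtype ∘ₗ e.toLinearMap
  have hi : Function.Injective i :=
    (Submodule.injective_subtype _).comp ((Submodule.injective_subtype _).comp e.injective)
  have hne : i w ≠ 0 := fun h0 => hw (hi (by simpa using h0))
  obtain ⟨k, hk⟩ := Function.ne_iff.1 hne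
  have : LinearMap.proj k ∘ₗ i ≠ 0 := fun h0 => hk (LinearMap.congr_fun h0 w)
  exact ⟨(LinearEquiv.ofBijective _ (LinearMap.bijective_of_ne_zero this)).symm⟩

end generalities

/-! ### Quasi-Frobenius rings -/

section quasiFrobenius

variable {R : Type u} [Ring R]

/-- From `1 = x + y` and `1 = x' + y'` one gets `1 = x x' + (x y' + y)`. This lets comaximality with
`P` pass to finite intersections. -/
theorem TwoSidedIdeal.sup_eq_top_of_mul_mem {I J K P : TwoSidedIdeal R} (hI : I ⊔ P = ⊤)
    (hJ : J ⊔ P = ⊤) (hK : ∀ x ∈ I, ∀ y ∈ J, x * y ∈ K) : K ⊔ P = ⊤ := by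
  rw [← TwoSidedIdeal.one_mem_iff] at hI hJ ⊢
  obtain ⟨x, hx, y, hy, hxy⟩ := TwoSidedIdeal.mem_sup.1 hI
  obtain ⟨x', hx', y', hy', hxy'⟩ := TwoSidedIdeal.mem_sup.1 hJ
  refine TwoSidedIdeal.mem_sup.2 ⟨x * x', hK _ hx _ hx', x * y' + y,
    P.add_mem (P.mul_mem_left _ _ hy') hy, ?_⟩
  rw [← add_assoc, ← mul_add, hxy', mul_one, hxy]

/-- By the descending chain condition some finite intersection of maximal ideals lies in all of
them. A maximal ideal outside this finite family would be comaximal with the intersection it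
contains. -/
theorem TwoSidedIdeal.finite_coatoms [IsArtinian Rᵐᵒᵖ R] :
    Finite {P : TwoSidedIdeal R // IsCoatom P} := by
  let F : TwoSidedIdeal R → Submodule Rᵐᵒᵖ R := fun I =>
    { carrier := I, add_mem' := I.add_mem, zero_mem' := I.zero_mem
      smul_mem' := fun r x hx => I.mul_mem_right _ _ hx }
  have hF : StrictMono F := fun I J hIJ => lt_of_le_of_ne (fun x hx => hIJ.le hx)
    (fun h => hIJ.ne (TwoSidedIdeal.ext fun x => SetLike.ext_iff.1 h x))
  have : WellFoundedLT (TwoSidedIdeal R) := hF.wellFoundedLT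
  obtain ⟨t, ht⟩ := Finset.exists_inf_le
    (fun P : {P : TwoSidedIdeal R // IsCoatom P} => (P : TwoSidedIdeal R))
  refine Set.finite_univ_iff.1 (t.finite_toSet.subset fun P _ => ?_)
  classical
  by_contra hP
  have key : ∀ s : Finset {P : TwoSidedIdeal R // IsCoatom P}, P ∉ s →
      s.inf (fun P => (P : TwoSidedIdeal R)) ⊔ P = ⊤ := by
    intro s
    induction s using Finset.induction_on with
    | empty => simp
    | insert Q s hQ ih =>
      intro hPs
      rw [Finset.mem_insert, not_or] at hPs
      rw [Finset.inf_insert]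
      have hQP : (Q : TwoSidedIdeal R) ⊔ P = ⊤ :=
        Q.2.sup_eq_top_of_ne P.2 (fun h => hPs.1 (Subtype.ext h.symm))
      refine TwoSidedIdeal.sup_eq_top_of_mul_mem hQP (ih hPs.2) fun x hx y hy => ?_
      exact (TwoSidedIdeal.mem_inf R).2 ⟨TwoSidedIdeal.mul_mem_right _ _ _ hx,
        TwoSidedIdeal.mul_mem_left _ _ _ hy⟩
  have := key t hP
  rw [sup_eq_right.2 (ht P)] at this
  exact P.2.1 this

/-- The annihilator of a right module, as a two-sided ideal. -/
def rightAnnihilator (R : Type u) [Ring R] (V : Type*) [AddCommGroup V] [Module Rᵐᵒᵖ V] :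
    TwoSidedIdeal R :=
  TwoSidedIdeal.mk' {a | ∀ v : V, MulOpposite.op a • v = 0} (by simp)
    (fun {x y} hx hy v => by simp [add_smul, hx v, hy v]) (fun {x} hx v => by simp [hx v])
    (fun {x y} hy v => by rw [MulOpposite.op_mul, mul_smul, hy])
    (fun {x y} hx v => by rw [MulOpposite.op_mul, mul_smul, hx, smul_zero])

theorem mem_rightAnnihilator {V : Type*} [AddCommGroup V] [Module Rᵐᵒᵖ V] {a : R} :
    a ∈ rightAnnihilator R V ↔ ∀ v : V, MulOpposite.op a • v = 0 := by
  simp [rightAnnihilator, TwoSidedIdeal.mem_mk']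

theorem IsArtinian.isArtinianRing_op [IsArtinian Rᵐᵒᵖ R] : IsArtinianRing Rᵐᵒᵖ :=
  (MulOpposite.opLinearEquiv Rᵐᵒᵖ : R ≃ₗ[Rᵐᵒᵖ] Rᵐᵒᵖ).isArtinian_iff.1 inferInstance

/-- For a proper two-sided ideal `K` strictly above the annihilator of `V`, choose a maximal right
ideal `m ⊇ K`. Then `K`, and so the annihilator of `V`, kills the simple module `R / m`; hence `V ≅
R / m` and `K` kills `V`, a contradiction. -/
theorem isCoatom_rightAnnihilator [IsArtinian Rᵐᵒᵖ R] (V : Type*) [AddCommGroup V]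
    [Module Rᵐᵒᵖ V] [IsSimpleModule Rᵐᵒᵖ V] : IsCoatom (rightAnnihilator R V) := by
  have := IsArtinian.isArtinianRing_op (R := R)
  have hnt := IsSimpleModule.nontrivial Rᵐᵒᵖ V
  refine ⟨fun h => ?_, fun K hK => ?_⟩
  · obtain ⟨v, hv⟩ := exists_ne (0 : V)
    have := mem_rightAnnihilator.1 ((TwoSidedIdeal.one_mem_iff _).2 h) v
    exact hv (by simpa using this)
  · by_contra hK'
    let K' : Ideal Rᵐᵒᵖ :=
      { carrier := {a | a.unop ∈ K}
        add_mem' := fun hx hy => K.add_mem hx hy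
        zero_mem' := K.zero_mem
        smul_mem' := fun r x hx => K.mul_mem_right _ _ hx }
    have hK'' : K' ≠ ⊤ := fun h => hK' ((TwoSidedIdeal.one_mem_iff _).1
      (show (1 : Rᵐᵒᵖ) ∈ K' from h ▸ Submodule.mem_top))
    obtain ⟨m, hm, hKm⟩ := (eq_top_or_exists_le_coatom K').resolve_left hK''
    have := isSimpleModule_iff_isCoatom.2 hm
    have hKW : ∀ a ∈ K, ∀ w : Rᵐᵒᵖ ⧸ m, MulOpposite.op a • w = 0 := by
      intro a ha w
      obtain ⟨r, rfl⟩ := m.mkQ_surjective w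
      rw [← map_smul]
      refine (Submodule.Quotient.mk_eq_zero m).2 (hKm ?_)
      exact K.mul_mem_left _ _ ha
    obtain ⟨e⟩ := IsSimpleModule.nonempty_linearEquiv_of_annihilator_le (Λ := Rᵐᵒᵖ) (V := V)
      (W := Rᵐᵒᵖ ⧸ m) (fun r hr => hKW r.unop (hK.le (mem_rightAnnihilator.2 hr)))
    refine hK.not_ge fun a ha => mem_rightAnnihilator.2 fun v => e.injective ?_
    rw [map_smul, map_zero, hKW a ha]

/-- If `R` is right self-injective, then finitely generated left ideals are left annihilators. -/
theorem Module.Injective.mem_span_range_of_annihilates (hinj : Module.Injective Rᵐᵒᵖ R)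
    {ι : Type u} [Finite ι] (a : ι → R) (x : R) (h : ∀ r, (∀ i, a i * r = 0) → x * r = 0) :
    x ∈ Ideal.span (Set.range a) := by
  classical
  have := Fintype.ofFinite ι
  let mulL : R → (R →ₗ[Rᵐᵒᵖ] R) := fun b =>
    { toFun := fun r => b * r
      map_add' := mul_add b
      map_smul' := fun r s => by simp [mul_assoc] }
  -- The hypothesis says that left multiplication by `x` vanishes on the kernel of `r ↦ (a i * r)`.
  -- The values at the standard basis of the resulting map `R^ι → R` are the coefficients that
  -- express `x` in the `a i`.
  obtain ⟨g, hg⟩ := hinj.exists_comp_eq_of_ker_le (LinearMap.pi fun i => mulL (a i)) (mulL x)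
    (fun r hr => h r fun i => congrFun (LinearMap.mem_ker.1 hr) i)
  have h1 := hg 1
  have h2 : (LinearMap.pi fun i => mulL (a i)) (1 : R) =
      ∑ i, MulOpposite.op (a i) • (Pi.single i 1 : ι → R) := by
    ext j
    simp [mulL, Finset.sum_apply, Pi.single_apply]
  rw [h2, map_sum] at h1
  have h3 : x = ∑ i, g (Pi.single i 1) * a i := by
    simpa [mulL] using h1.symm
  rw [h3]
  exact Ideal.sum_mem _ fun i _ => Ideal.mul_mem_left _ _ (Ideal.subset_span ⟨i, rfl⟩)

/-- The right annihilator of a left ideal `L` is, by the descending chain condition, already that of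
finitely many elements of `L`. The left ideal they generate is a left annihilator, so it contains
`L`. -/
theorem IsQFRing.isNoetherianRing (hR : IsQFRing R) : IsNoetherianRing R := by
  have := hR.artinian
  refine ⟨fun L => ?_⟩
  let f : L → Submodule Rᵐᵒᵖ R := fun y =>
    { carrier := {r | (y : R) * r = 0}
      add_mem' := fun {r s} hr hs => by
        simp only [Set.mem_ofPred_eq] at hr hs ⊢; rw [mul_add, hr, hs, add_zero]
      zero_mem' := mul_zero _
      smul_mem' := fun s r hr => by
        simp only [Set.mem_ofPred_eq] at hr ⊢
        rw [MulOpposite.smul_eq_mul_unop, ← mul_assoc, hr, zero_mul] }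
  obtain ⟨t, ht⟩ := Finset.exists_inf_le f
  have hL : L = Ideal.span (Set.range fun i : t => ((i : L) : R)) := by
    refine le_antisymm (fun x hx => ?_) (Ideal.span_le.2 ?_)
    · refine hR.injective.mem_span_range_of_annihilates _ x fun r hr => ?_
      refine ht ⟨x, hx⟩ ?_
      rw [Finset.inf_eq_iInf]
      simp only [Submodule.mem_iInf]
      exact fun y hy => hr ⟨y, hy⟩
    · rintro _ ⟨i, rfl⟩
      exact i.1.2
  rw [hL]
  exact Submodule.fg_span (Set.finite_range _)

/-- Left ideals of a quasi-Frobenius ring are left annihilators. -/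
theorem IsQFRing.mem_of_annihilates (hR : IsQFRing R) (L : Ideal R) (x : R)
    (h : ∀ r, (∀ y ∈ L, y * r = 0) → x * r = 0) : x ∈ L := by
  have := hR.isNoetherianRing
  obtain ⟨s, hs⟩ := (isNoetherian_def.1 this L)
  have h1 := hR.injective.mem_span_range_of_annihilates (ι := s) Subtype.val x (fun r hr => h r ?_)
  · rwa [Subtype.range_coe_subtype, Finset.setOfPred_mem, Ideal.span, hs] at h1
  · rw [← hs]
    intro y hy
    induction hy using Submodule.span_induction with
    | mem y hy => exact hr ⟨y, hy⟩
    | zero => simp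
    | add y z _ _ hy hz => rw [add_mul, hy, hz, add_zero]
    | smul a y _ hy => rw [smul_eq_mul, mul_assoc, hy, mul_zero]

/-- The right annihilator of a left ideal. -/
def Ideal.rightAnn (L : Ideal R) : Submodule Rᵐᵒᵖ R where
  carrier := {r | ∀ y ∈ L, y * r = 0}
  add_mem' {r s} hr hs y hy := by rw [mul_add, hr y hy, hs y hy, add_zero]
  zero_mem' y _ := mul_zero y
  smul_mem' s r hr y hy := by
    rw [MulOpposite.smul_eq_mul_unop, ← mul_assoc, hr y hy, zero_mul]

theorem IsQFRing.isNoetherian_op (hR : IsQFRing R) : IsNoetherian Rᵐᵒᵖ R := by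
  have := hR.artinian
  have := IsArtinian.isArtinianRing_op (R := R)
  exact (MulOpposite.opLinearEquiv Rᵐᵒᵖ : R ≃ₗ[Rᵐᵒᵖ] Rᵐᵒᵖ).isNoetherian_iff.2 inferInstance

/-- Since left ideals are left annihilators, `L ↦ rightAnn L` strictly reverses inclusions, and the
ascending chain condition on right ideals becomes the descending one on left ideals. -/
theorem IsQFRing.isArtinianRing (hR : IsQFRing R) : IsArtinianRing R := by
  have := hR.isNoetherian_op
  have hF : StrictMono fun L : Ideal R => OrderDual.toDual L.rightAnn := by
    refine fun L L' hL => lt_of_le_not_ge (fun r hr y hy => hr y (hL.le hy)) fun h => ?_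
    exact hL.not_ge fun x hx => hR.mem_of_annihilates L x fun r hr => h hr x hx
  exact hF.wellFoundedLT

/-- Each simple right module over a quasi-Frobenius ring embeds in the ring. -/
theorem IsQFRing.exists_ne_zero_right (hR : IsQFRing R) (W : Type u) [AddCommGroup W]
    [Module Rᵐᵒᵖ W] [IsSimpleModule Rᵐᵒᵖ W] : ∃ f : W →ₗ[Rᵐᵒᵖ] R, f ≠ 0 := by
  have := hR.artinian
  have := IsArtinian.isArtinianRing_op (R := R)
  -- A maximal ideal has nonzero right annihilator, for otherwise the double annihilator property
  -- would put `1` in it. So it kills some minimal right ideal from the left.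
  have h1 : ∀ P : {P : TwoSidedIdeal R // IsCoatom P}, ∃ V : Submodule Rᵐᵒᵖ R,
      IsAtom V ∧ ∀ a ∈ P.1, ∀ v ∈ V, a * v = 0 := by
    rintro ⟨P, hP⟩
    let L : Ideal R :=
      { carrier := P, add_mem' := P.add_mem, zero_mem' := P.zero_mem
        smul_mem' := fun r x hx => P.mul_mem_left _ _ hx }
    have hne : L.rightAnn ≠ ⊥ := by
      intro h0
      refine hP.1 ((TwoSidedIdeal.one_mem_iff _).1 ?_)
      refine hR.mem_of_annihilates L 1 fun r hr => ?_
      have : r ∈ L.rightAnn := hr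
      rw [h0, Submodule.mem_bot] at this
      simp [this]
    obtain ⟨V, hV, hle⟩ := (eq_bot_or_exists_atom_le L.rightAnn).resolve_left hne
    exact ⟨V, hV, fun a ha v hv => hle hv a ha⟩
  choose V hV hPV using h1
  have hsimple : ∀ P, IsSimpleModule Rᵐᵒᵖ (V P) := fun P => isSimpleModule_iff_isAtom.2 (hV P)
  -- A Nakayama permutation: `P` is the left annihilator of the two-sided ideal `R V_P`, and `φ P`
  -- is its right annihilator. An injective self-map of the finite set of maximal ideals is
  -- surjective, so every simple right module shares its annihilator with some minimal right ideal.
  let φ : {P : TwoSidedIdeal R // IsCoatom P} → {P : TwoSidedIdeal R // IsCoatom P} := fun P =>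
    ⟨rightAnnihilator R (V P), isCoatom_rightAnnihilator (V P)⟩
  have hmem : ∀ P a, a ∈ rightAnnihilator R (V P) ↔ ∀ v ∈ V P, v * a = 0 := fun P a => by
    rw [mem_rightAnnihilator]
    refine ⟨fun h v hv => ?_, fun h v => Subtype.ext (h v v.2)⟩
    simpa using congrArg Subtype.val (h ⟨v, hv⟩)
  have hann : ∀ P (a : R), (∀ y ∈ Ideal.span (V P : Set R), y * a = 0) ↔
      a ∈ rightAnnihilator R (V P) := by
    refine fun P a => ⟨fun h => (hmem P a).2 fun v hv => h v (Ideal.subset_span hv), fun h y hy => ?_⟩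
    induction hy using Submodule.span_induction with
    | mem y hy => exact (hmem P a).1 h y hy
    | zero => simp
    | add y z _ _ hy hz => rw [add_mul, hy, hz, add_zero]
    | smul r y _ hy => rw [smul_eq_mul, mul_assoc, hy, mul_zero]
  have hφ : Function.Injective φ := by
    have main : ∀ P P', φ P = φ P' → P.1 ≤ P'.1 := by
      intro P P' hPP
      have hPP' : rightAnnihilator R (V P) = rightAnnihilator R (V P') := congrArg Subtype.val hPP
      let L : TwoSidedIdeal R := TwoSidedIdeal.mk'
        {a | ∀ (r v : R), v ∈ V P' → a * r * v = 0} (by simp)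
        (fun {x y} hx hy r v hv => by simp [add_mul, hx r v hv, hy r v hv])
        (fun {x} hx r v hv => by simp [hx r v hv])
        (fun {x y} hy r v hv => by
          have := hy r v hv
          simp only [mul_assoc] at this ⊢
          rw [this, mul_zero])
        (fun {x y} hx r v hv => by rw [mul_assoc x y r]; exact hx _ v hv)
      have hL : ∀ a, a ∈ L ↔ ∀ (r v : R), v ∈ V P' → a * r * v = 0 := fun a => by
        simp [L, TwoSidedIdeal.mem_mk']
      have hle : P'.1 ≤ L := fun a ha => (hL a).2 fun r v hv =>
        hPV P' _ (P'.1.mul_mem_right _ _ ha) v hv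
      have hLtop : L ≠ ⊤ := by
        intro h0
        refine (hV P').1 ((Submodule.eq_bot_iff _).2 fun v hv => ?_)
        simpa using (hL 1).1 ((TwoSidedIdeal.one_mem_iff _).2 h0) 1 v hv
      -- The left annihilator `L` of `R V_{P'}` is proper and contains the maximal ideal `P'`. It
      -- remains to see that `P` kills `R V_{P'}`, which holds because equal right annihilators
      -- force `V_{P'} ⊆ R V_P`.
      have hLP : L = P'.1 := ((P'.2.le_iff.1 hle).resolve_left hLtop)
      rw [← hLP]
      intro a ha
      refine (hL a).2 fun r v hv => ?_
      have hv' : v ∈ Ideal.span (V P : Set R) := by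
        refine hR.mem_of_annihilates _ v fun s hs => ?_
        rw [hann, hPP', hmem] at hs
        exact hs v hv
      have hz : ∀ y ∈ Ideal.span (V P : Set R), ∀ a ∈ P.1, a * y = 0 := by
        intro y hy
        induction hy using Submodule.span_induction with
        | mem y hy => exact fun a ha => hPV P a ha y hy
        | zero => simp
        | add y z _ _ hy hz => intro a ha; rw [mul_add, hy a ha, hz a ha, add_zero]
        | smul r y _ hy =>
          intro a ha
          rw [smul_eq_mul, ← mul_assoc]
          exact hy _ (P.1.mul_mem_right _ _ ha)
      exact hz v hv' _ (P.1.mul_mem_right _ _ ha)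
    exact fun P P' h => Subtype.ext (le_antisymm (main P P' h) (main P' P h.symm))
  have := TwoSidedIdeal.finite_coatoms (R := R)
  obtain ⟨P, hP⟩ := Finite.surjective_of_injective hφ
    ⟨rightAnnihilator R W, isCoatom_rightAnnihilator W⟩
  have hP' : rightAnnihilator R (V P) = rightAnnihilator R W := congrArg Subtype.val hP
  obtain ⟨e⟩ := IsSimpleModule.nonempty_linearEquiv_of_annihilator_le (Λ := Rᵐᵒᵖ) (V := W)
    (W := V P) (fun r hr => mem_rightAnnihilator.1
      (show r.unop ∈ _ from hP' ▸ mem_rightAnnihilator.2 hr))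
  have := IsSimpleModule.nontrivial Rᵐᵒᵖ W
  obtain ⟨w, hw⟩ := exists_ne (0 : W)
  refine ⟨(V P).subtype ∘ₗ e.toLinearMap, fun h => hw ?_⟩
  exact e.injective (Subtype.ext (by simpa using LinearMap.congr_fun h w))

/-- Each simple left module over a quasi-Frobenius ring embeds in the ring. -/
theorem IsQFRing.exists_ne_zero_left (hR : IsQFRing R) (W : Type u) [AddCommGroup W]
    [Module R W] [IsSimpleModule R W] : ∃ f : W →ₗ[R] R, f ≠ 0 := by
  have := IsSimpleModule.nontrivial R W
  obtain ⟨w, hw⟩ := exists_ne (0 : W)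
  let p := LinearMap.toSpanSingleton R W w
  -- The proper left ideal `ker p` is a left annihilator, so it kills some `x ≠ 0`; the embedding
  -- will send `w` to `x`.
  have hx : ∃ x : R, x ≠ 0 ∧ ∀ y ∈ LinearMap.ker p, y * x = 0 := by
    by_contra! h
    refine hw ?_
    have h1 := hR.mem_of_annihilates (LinearMap.ker p) 1 (fun r hr => ?_)
    · simpa [p] using h1
    · by_contra hr0
      obtain ⟨y, hy, hyr⟩ := h r (by simpa using hr0)
      exact hyr (hr y hy)
  obtain ⟨x, hx0, hx⟩ := hx
  let q := LinearMap.toSpanSingleton R R x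
  have hpq : LinearMap.ker p ≤ LinearMap.ker q := fun y hy => hx y hy
  let e := p.quotKerEquivOfSurjective (IsSimpleModule.toSpanSingleton_surjective R hw)
  refine ⟨(LinearMap.ker p).liftQ q hpq ∘ₗ e.symm.toLinearMap, fun h0 => hx0 ?_⟩
  have h1 : e.symm w = (LinearMap.ker p).mkQ 1 := by
    rw [LinearEquiv.symm_apply_eq]
    simp [e, p]
  have := LinearMap.congr_fun h0 w
  rw [LinearMap.comp_apply, LinearEquiv.coe_coe, h1, Submodule.mkQ_apply,
    Submodule.liftQ_apply] at this
  simpa [q] using this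

/-- Baer's criterion for `L = ∑ R s_i` and `f : L → R` asks for `c` with `s_i c = f(s_i)` for all
`i`. If `(f(s_i))` were outside the right submodule `{(s_i r)}`, the cogenerator `R` would supply a
row `(d_i)` killing that submodule but not `(f(s_i))`. But `∑ d_i s_i = 0` implies `∑ d_i f(s_i) =
0`. -/
theorem IsQFRing.injective_left (hR : IsQFRing R) : Module.Injective R R := by
  refine Module.Baer.injective fun L f => ?_
  have := hR.isNoetherianRing
  obtain ⟨s, hs⟩ := (isNoetherian_def.1 this L)
  have hsL : ∀ i : s, (i : R) ∈ L := fun i => hs ▸ Submodule.subset_span i.2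
  let b : s → R := fun i => f ⟨i, hsL i⟩
  let v : R →ₗ[Rᵐᵒᵖ] (s → R) :=
    { toFun := fun r i => i * r
      map_add' := fun r r' => by ext i; simp [mul_add]
      map_smul' := fun r r' => by ext i; simp [mul_assoc] }
  have hb : b ∈ LinearMap.range v := by
    by_contra hb
    classical
    obtain ⟨g, hg⟩ := hR.injective.exists_apply_ne_zero
      (fun W _ _ _ => hR.exists_ne_zero_right W) (Z := (s → R) ⧸ LinearMap.range v)
      (z := (LinearMap.range v).mkQ b)
      (fun h0 => hb ((Submodule.Quotient.mk_eq_zero _).1 h0))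
    let d : s → R := fun i => g ((LinearMap.range v).mkQ (Pi.single i 1))
    have hd : ∀ y : s → R, g ((LinearMap.range v).mkQ y) = ∑ i, d i * y i := by
      intro y
      have hy : y = ∑ i, MulOpposite.op (y i) • (Pi.single i 1 : s → R) := by
        ext j
        simp [Finset.sum_apply, Pi.single_apply]
      conv_lhs => rw [hy]
      simp [d, map_sum, -Submodule.mkQ_apply]
    have h1 : ∑ i, d i * (i : R) = 0 := by
      have h2 := hd (v 1)
      have h3 : (LinearMap.range v).mkQ (v 1) = 0 :=
        (Submodule.Quotient.mk_eq_zero _).2 (LinearMap.mem_range_self v 1)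
      rw [h3, map_zero] at h2
      simpa [v] using h2.symm
    apply hg
    rw [hd]
    have h4 : f (∑ i, d i • (⟨i, hsL i⟩ : L)) = ∑ i, d i * b i := by
      rw [map_sum]
      exact Finset.sum_congr rfl fun i _ => by rw [map_smul, smul_eq_mul]
    rw [← h4]
    have h5 : (∑ i, d i • (⟨i, hsL i⟩ : L)) = 0 := by
      apply Subtype.ext
      simpa using h1
    rw [h5, map_zero]
  obtain ⟨c, hc⟩ := hb
  refine ⟨LinearMap.toSpanSingleton R R c, fun x hx => ?_⟩
  have hx' : x ∈ Submodule.span R (s : Set R) := hs ▸ hx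
  have key : ∀ x ∈ Submodule.span R (s : Set R), ∀ hx : x ∈ L, x * c = f ⟨x, hx⟩ := by
    intro x hx
    induction hx using Submodule.span_induction with
    | mem y hy => exact fun _ => congrFun hc ⟨y, hy⟩
    | zero => intro h; rw [zero_mul]; exact (map_zero f).symm
    | add y z hy hz h1 h2 =>
      intro h
      have hy' : y ∈ L := hs ▸ hy
      have hz' : z ∈ L := hs ▸ hz
      rw [add_mul, h1 hy', h2 hz', ← map_add]; rfl
    | smul r y hy h1 =>
      intro h
      have hy' : y ∈ L := hs ▸ hy
      refine (mul_assoc r y c).trans ?_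
      rw [h1 hy', ← smul_eq_mul, ← map_smul]; rfl
  simpa using key x hx' hx

end quasiFrobenius

/-! ### Projective covers in a class of modules

The classes of modules considered are closed under submodules, quotients and direct sums, and their
cyclic members have finite length. -/

section coverClasses

variable {A : Type u} [Ring A]

/-- A class of modules closed under submodules, quotients and direct sums, whose cyclic members are
noetherian and artinian. -/
structure IsLocallyFiniteClass
    (𝒦 : ∀ (M : Type u) [AddCommGroup M] [Module A M], Prop) : Prop where
  of_injective : ∀ {M N : Type u} [AddCommGroup M] [Module A M] [AddCommGroup N] [Module A N]
    (f : M →ₗ[A] N), Function.Injective f → 𝒦 N → 𝒦 M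
  of_surjective : ∀ {M N : Type u} [AddCommGroup M] [Module A M] [AddCommGroup N] [Module A N]
    (f : M →ₗ[A] N), Function.Surjective f → 𝒦 M → 𝒦 N
  dfinsupp : ∀ {ι : Type u} (M : ι → Type u) [∀ i, AddCommGroup (M i)] [∀ i, Module A (M i)],
    (∀ i, 𝒦 (M i)) → 𝒦 (Π₀ i, M i)
  isNoetherian_span : ∀ {M : Type u} [AddCommGroup M] [Module A M], 𝒦 M → ∀ m : M,
    IsNoetherian A (Submodule.span A {m})
  isArtinian_span : ∀ {M : Type u} [AddCommGroup M] [Module A M], 𝒦 M → ∀ m : M,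
    IsArtinian A (Submodule.span A {m})

variable (𝒦 : ∀ (M : Type u) [AddCommGroup M] [Module A M], Prop)

/-- Projectivity with respect to a class of modules. -/
def IsClassProjective (P : Type u) [AddCommGroup P] [Module A P] : Prop :=
  ∀ {Y Z : Type u} [AddCommGroup Y] [Module A Y] [AddCommGroup Z] [Module A Z], 𝒦 Y → 𝒦 Z →
    ∀ (p : Y →ₗ[A] Z), Function.Surjective p → ∀ g : P →ₗ[A] Z, ∃ h : P →ₗ[A] Y, p ∘ₗ h = g

/-- Injectivity with respect to a class of modules. -/
def IsClassInjective (E : Type u) [AddCommGroup E] [Module A E] : Prop :=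
  ∀ {Y : Type u} [AddCommGroup Y] [Module A Y], 𝒦 Y → ∀ (N : Submodule A Y) (g : N →ₗ[A] E),
    ∃ h : Y →ₗ[A] E, ∀ n : N, h n = g n

/-- Existence of a projective cover in a class of modules. -/
def HasClassCover (M : Type u) [AddCommGroup M] [Module A M] : Prop :=
  ∃ (P : Type u) (_ : AddCommGroup P) (_ : Module A P) (f : P →ₗ[A] M),
    𝒦 P ∧ IsClassProjective 𝒦 P ∧ Function.Surjective f ∧
      ∀ L : Submodule A P, LinearMap.ker f ⊔ L = ⊤ → L = ⊤

variable {𝒦}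

/-- A module with superfluous kernel over a simple module is local. -/
theorem le_ker_of_superfluous {P S : Type*} [AddCommGroup P] [Module A P]
    [AddCommGroup S] [Module A S] [IsSimpleModule A S] {f : P →ₗ[A] S}
    (hf : Function.Surjective f) (hs : ∀ L : Submodule A P, LinearMap.ker f ⊔ L = ⊤ → L = ⊤)
    {L : Submodule A P} (hL : L ≠ ⊤) : L ≤ LinearMap.ker f := by
  have hK : IsCoatom (LinearMap.ker f) := LinearMap.isCoatom_ker_of_surjective hf
  by_contra h
  refine hL (hs L (hK.2 _ ?_))
  exact left_lt_sup.2 h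

/-- Every proper submodule lies in `ker f`, so any element outside `ker f` generates. Covers of
simple modules are thereby cyclic, hence finite over the base ring when rational. -/
theorem span_eq_top_of_superfluous {P S : Type*} [AddCommGroup P] [Module A P]
    [AddCommGroup S] [Module A S] [IsSimpleModule A S] {f : P →ₗ[A] S}
    (hf : Function.Surjective f) (hs : ∀ L : Submodule A P, LinearMap.ker f ⊔ L = ⊤ → L = ⊤) :
    ∃ p : P, Submodule.span A {p} = ⊤ := by
  have := IsSimpleModule.nontrivial A S
  obtain ⟨s, hs0⟩ := exists_ne (0 : S)
  obtain ⟨p, rfl⟩ := hf s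
  refine ⟨p, by_contra fun h => hs0 ?_⟩
  exact le_ker_of_superfluous hf hs h (Submodule.mem_span_singleton_self p)

namespace IsLocallyFiniteClass

theorem exists_isSimpleModule (h𝒦 : IsLocallyFiniteClass 𝒦) {M : Type u} [AddCommGroup M] [Module A M] [Nontrivial M]
    (hM : 𝒦 M) : ∃ S : Submodule A M, IsSimpleModule A S := by
  obtain ⟨m, hm⟩ := exists_ne (0 : M)
  let N := Submodule.span A {m}
  have := h𝒦.isArtinian_span hM m
  obtain ⟨S, hS, -⟩ := (eq_bot_or_exists_atom_le (⊤ : Submodule A N)).resolve_left (by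
    intro h
    have : (⟨m, Submodule.mem_span_singleton_self m⟩ : N) ∈ (⊤ : Submodule A N) := trivial
    rw [h, Submodule.mem_bot] at this
    exact hm (congrArg Subtype.val this))
  have := isSimpleModule_iff_isAtom.2 hS
  exact ⟨S.map N.subtype,
    IsSimpleModule.congr (Submodule.equivMapOfInjective _ N.injective_subtype S).symm⟩

/-- Embed a simple submodule in a noetherian injective `E` and extend to `M → E`. The image is
nonzero and noetherian, so it has a maximal submodule, whose preimage is maximal in `M`. -/
theorem exists_isCoatom (h𝒦 : IsLocallyFiniteClass 𝒦)
    (hE : ∀ (S : Type u) [AddCommGroup S] [Module A S], 𝒦 S →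
      IsSimpleModule A S → ∃ (E : Type u) (_ : AddCommGroup E) (_ : Module A E) (i : S →ₗ[A] E),
        Function.Injective i ∧ IsNoetherian A E ∧ IsClassInjective 𝒦 E)
    {M : Type u} [AddCommGroup M] [Module A M] [Nontrivial M] (hM : 𝒦 M) :
    ∃ N : Submodule A M, IsCoatom N := by
  obtain ⟨S, hS⟩ := h𝒦.exists_isSimpleModule hM
  obtain ⟨E, _, _, i, hi, _, hE⟩ := hE S (h𝒦.of_injective S.subtype S.injective_subtype hM) hS
  obtain ⟨h, hh⟩ := hE hM S i
  have := IsSimpleModule.nontrivial A S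
  obtain ⟨s, hs⟩ := exists_ne (0 : S)
  have : Nontrivial (LinearMap.range h) := by
    refine ⟨⟨⟨h s, LinearMap.mem_range_self _ _⟩, 0, fun h0 => hs (hi ?_)⟩⟩
    rw [map_zero, ← hh]
    exact congrArg Subtype.val h0
  obtain ⟨N, hN, -⟩ :=
    (eq_top_or_exists_le_coatom (⊥ : Submodule A (LinearMap.range h))).resolve_left bot_ne_top
  have := isSimpleModule_iff_isCoatom.2 hN
  exact ⟨_, LinearMap.isCoatom_ker_of_surjective (f := N.mkQ ∘ₗ h.rangeRestrict)
    (N.mkQ_surjective.comp h.surjective_rangeRestrict)⟩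

/-- A maximal submodule of `M / L` pulls back to a maximal submodule of `M`, which contains both the
radical and `L`. -/
theorem jacobson_superfluous {M : Type u} [AddCommGroup M] [Module A M]
    (hM : ∀ L : Submodule A M, L ≠ ⊤ → ∃ N : Submodule A (M ⧸ L), IsCoatom N)
    (L : Submodule A M) (h : Module.jacobson A M ⊔ L = ⊤) : L = ⊤ := by
  by_contra hL
  obtain ⟨N, hN⟩ := hM L hL
  have h1 := isSimpleModule_iff_isCoatom.2 hN
  have h2 : IsCoatom (LinearMap.ker (N.mkQ ∘ₗ L.mkQ)) := LinearMap.isCoatom_ker_of_surjective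
    (N.mkQ_surjective.comp L.mkQ_surjective)
  refine h2.1 (eq_top_iff.2 (h ▸ sup_le (sInf_le h2) fun x hx => ?_))
  have : L.mkQ x = 0 := (Submodule.Quotient.mk_eq_zero _).2 hx
  rw [LinearMap.mem_ker, LinearMap.comp_apply, this, map_zero]

theorem isClassProjective_dfinsupp {ι : Type u} (P : ι → Type u) [∀ i, AddCommGroup (P i)]
    [∀ i, Module A (P i)] (hP : ∀ i, IsClassProjective 𝒦 (P i)) :
    IsClassProjective 𝒦 (Π₀ i, P i) := by
  classical
  intro Y Z _ _ _ _ hY hZ p hp g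
  choose h hh using fun i => hP i hY hZ p hp (g ∘ₗ DFinsupp.lsingle i)
  refine ⟨DFinsupp.lsum ℕ h, DFinsupp.lhom_ext fun i x => ?_⟩
  have := LinearMap.congr_fun (hh i) x
  simpa using this

/-- If `X` has zero radical and the simple modules have projective covers, then `X` is
semisimple. -/
theorem isSemisimpleModule_of_jacobson_eq_bot (h𝒦 : IsLocallyFiniteClass 𝒦)
    (hP : ∀ (S : Type u) [AddCommGroup S] [Module A S], 𝒦 S → IsSimpleModule A S →
      HasClassCover 𝒦 S) {X : Type u} [AddCommGroup X] [Module A X] (hX : 𝒦 X)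
    (hJ : Module.jacobson A X = ⊥) : IsSemisimpleModule A X := by
  refine sSup_simples_eq_top_iff_isSemisimpleModule.1 ?_
  set T := sSup {m : Submodule A X | IsSimpleModule A m} with hT
  refine eq_top_iff.2 fun x _ => by_contra fun hx => ?_
  let N := Submodule.span A {x}
  have := h𝒦.isNoetherian_span hX x
  -- If `x` lies outside the socle `T`, then `T ∩ A x` sits in a maximal submodule `K` of the
  -- noetherian module `A x`. The cover of `A x / K` will produce a simple submodule of `A x` not
  -- contained in `K`.
  have hne : T.comap N.subtype ≠ ⊤ := by
    intro h0
    have : (⟨x, Submodule.mem_span_singleton_self x⟩ : N) ∈ T.comap N.subtype := h0 ▸ trivial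
    exact hx this
  obtain ⟨K, hK, hTK⟩ := (eq_top_or_exists_le_coatom _).resolve_left hne
  have := isSimpleModule_iff_isCoatom.2 hK
  have hN : 𝒦 N := h𝒦.of_injective N.subtype N.injective_subtype hX
  have hNK : 𝒦 (N ⧸ K) := h𝒦.of_surjective K.mkQ K.mkQ_surjective hN
  obtain ⟨P, _, _, f, hPK, hPP, hf, hs⟩ := hP (N ⧸ K) hNK inferInstance
  obtain ⟨g, hg⟩ := hPP hN hNK K.mkQ K.mkQ_surjective f
  let g' : P →ₗ[A] X := N.subtype ∘ₗ g
  have hJP : LinearMap.ker f ≤ Module.jacobson A P := by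
    refine le_sInf fun L hL => ?_
    have h1 := le_ker_of_superfluous hf hs hL.1
    have h2 : IsCoatom (LinearMap.ker f) := LinearMap.isCoatom_ker_of_surjective hf
    exact ((hL.le_iff.1 h1).resolve_left h2.1).le
  -- The kernel of the cover lies in the radical of `P`, whose image lies in the radical of `X`,
  -- which is zero. So `g'` factors through the simple module `N ⧸ K`.
  have hker : LinearMap.ker f ≤ LinearMap.ker g' := by
    intro y hy
    have := Module.le_comap_jacobson g' (hJP hy)
    rw [Submodule.mem_comap, hJ, Submodule.mem_bot] at this
    exact this
  have := IsSimpleModule.nontrivial A (N ⧸ K)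
  obtain ⟨z, hz⟩ := exists_ne (0 : N ⧸ K)
  obtain ⟨y, rfl⟩ := hf z
  have hgy : g' y ≠ 0 := by
    intro h0
    have h1 : g y = 0 := N.injective_subtype (by rw [map_zero]; exact h0)
    rw [← hg, LinearMap.comp_apply, h1, map_zero] at hz
    exact hz rfl
  have hrange : IsSimpleModule A (LinearMap.range g') := by
    have e1 := g'.quotKerEquivRange
    have : LinearMap.ker g' = LinearMap.ker f := by
      have h2 : IsCoatom (LinearMap.ker f) := LinearMap.isCoatom_ker_of_surjective hf
      refine (h2.le_iff.1 hker).resolve_left fun h0 => hgy ?_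
      exact LinearMap.mem_ker.1 (h0 ▸ Submodule.mem_top)
    rw [this] at e1
    exact IsSimpleModule.congr (e1.symm.trans (f.quotKerEquivOfSurjective hf))
  have hmem : g' y ∈ T := le_sSup (a := LinearMap.range g') hrange (LinearMap.mem_range_self g' y)
  have : g y ∈ K := hTK hmem
  rw [← hg, LinearMap.comp_apply] at hz
  exact hz ((Submodule.Quotient.mk_eq_zero K).2 this)

/-- If the simple modules have projective covers and embed in noetherian injectives, then all modules
have projective covers. -/
theorem hasClassCover (h𝒦 : IsLocallyFiniteClass 𝒦)
    (hP : ∀ (S : Type u) [AddCommGroup S] [Module A S], 𝒦 S → IsSimpleModule A S →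
      HasClassCover 𝒦 S)
    (hE : ∀ (S : Type u) [AddCommGroup S] [Module A S], 𝒦 S →
      IsSimpleModule A S → ∃ (E : Type u) (_ : AddCommGroup E) (_ : Module A E) (i : S →ₗ[A] E),
        Function.Injective i ∧ IsNoetherian A E ∧ IsClassInjective 𝒦 E)
    (M : Type u) [AddCommGroup M] [Module A M] (hM : 𝒦 M) : HasClassCover 𝒦 M := by
  classical
  have hcoatom : ∀ {N : Type u} [AddCommGroup N] [Module A N], 𝒦 N → ∀ L : Submodule A N, L ≠ ⊤ →
      ∃ K : Submodule A (N ⧸ L), IsCoatom K := by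
    intro N _ _ hN L hL
    have := Submodule.Quotient.nontrivial_iff.2 hL
    exact h𝒦.exists_isCoatom hE (h𝒦.of_surjective L.mkQ L.mkQ_surjective hN)
  let X := M ⧸ Module.jacobson A M
  have hX : 𝒦 X := h𝒦.of_surjective _ (Submodule.mkQ_surjective _) hM
  have := h𝒦.isSemisimpleModule_of_jacobson_eq_bot hP hX (Module.jacobson_quotient_jacobson A M)
  obtain ⟨s, e, -, hs⟩ := IsSemisimpleModule.exists_linearEquiv_dfinsupp A X
  choose P hP1 hP2 f hPK hPP hf hsup using fun i : s =>
    hP i.1 (h𝒦.of_injective i.1.subtype i.1.injective_subtype hX) (hs i)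
  let Q := Π₀ i, P i
  have hQ : 𝒦 Q := h𝒦.dfinsupp P hPK
  have hQP : IsClassProjective 𝒦 Q := isClassProjective_dfinsupp P hPP
  let π : Q →ₗ[A] X := e.symm.toLinearMap ∘ₗ DFinsupp.mapRange.linearMap f
  have hπ : Function.Surjective π :=
    e.symm.surjective.comp ((DFinsupp.mapRange_surjective _ fun i => map_zero _).2 hf)
  have hJP : ∀ i, LinearMap.ker (f i) ≤ Module.jacobson A (P i) := by
    refine fun i => le_sInf fun L hL => ?_
    have := hs i
    have h1 := le_ker_of_superfluous (hf i) (hsup i) hL.1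
    have h2 : IsCoatom (LinearMap.ker (f i)) := LinearMap.isCoatom_ker_of_surjective (hf i)
    exact ((hL.le_iff.1 h1).resolve_left h2.1).le
  -- Each component of a kernel element lies in the radical of its summand, and inclusions of
  -- summands preserve radicals. No finiteness of the sum is needed.
  have hkerπ : LinearMap.ker π ≤ Module.jacobson A Q := by
    intro q hq
    have hq' : ∀ i, f i (q i) = 0 := by
      intro i
      have : DFinsupp.mapRange.linearMap f q = 0 := 
        e.symm.injective ((LinearMap.mem_ker.1 hq).trans (map_zero _).symm)
      simpa using DFunLike.congr_fun this i
    rw [← DFinsupp.sum_single (f := q)]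
    refine Submodule.sum_mem _ fun i _ => ?_
    exact Module.le_comap_jacobson (DFinsupp.lsingle i : P i →ₗ[A] Q) (hJP i (hq' i))
  -- The lift `g` hits `M` modulo its superfluous radical, so it is surjective; its kernel lies in
  -- `ker π`, hence in the superfluous radical of `Q`.
  obtain ⟨g, hg⟩ := hQP hM hX (Submodule.mkQ _) (Submodule.mkQ_surjective _) π
  refine ⟨Q, inferInstance, inferInstance, g, hQ, hQP, ?_, fun L hL => ?_⟩
  · refine LinearMap.range_eq_top.1 (jacobson_superfluous (hcoatom hM) _ (eq_top_iff.2 ?_))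
    intro m _
    obtain ⟨q, hq⟩ := hπ ((Module.jacobson A M).mkQ m)
    rw [← hg, LinearMap.comp_apply] at hq
    have : m - g q ∈ Module.jacobson A M := (Submodule.Quotient.eq _).1 hq.symm
    exact Submodule.mem_sup.2 ⟨_, this, _, LinearMap.mem_range_self g q, sub_add_cancel _ _⟩
  · refine jacobson_superfluous (hcoatom hQ) L (eq_top_iff.2 (hL ▸ sup_le_sup_right ?_ L))
    refine le_trans (fun q hq => ?_) hkerπ
    rw [LinearMap.mem_ker] at hq ⊢
    rw [← hg, LinearMap.comp_apply, hq, map_zero]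

end IsLocallyFiniteClass

end coverClasses

/-! ### A Baer criterion on cyclic members of a class -/

section cyclicInjectivity

variable {A : Type u} [Ring A] {𝒦 : ∀ (M : Type u) [AddCommGroup M] [Module A M], Prop}

/-- Injectivity with respect to a class of modules can be tested on the cyclic members. -/
theorem IsLocallyFiniteClass.isClassInjective_of_cyclic (h𝒦 : IsLocallyFiniteClass 𝒦) {E : Type u}
    [AddCommGroup E] [Module A E]
    (hE : ∀ {Y : Type u} [AddCommGroup Y] [Module A Y], 𝒦 Y → (∃ y : Y, Submodule.span A {y} = ⊤) →
      ∀ (N : Submodule A Y) (g : N →ₗ[A] E), ∃ h : Y →ₗ[A] E, ∀ n : N, h n = g n) :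
    IsClassInjective 𝒦 E := by
  intro Y _ _ hY N g
  let f₀ : Y →ₗ.[A] E := ⟨N, g⟩
  obtain ⟨f, hf₀, hmax⟩ := zorn_le_nonempty₀ {f : Y →ₗ.[A] E | f₀ ≤ f} (fun c hc hchain f hf => by
    refine ⟨LinearPMap.sSup c hchain.directedOn, ?_, fun z hz => LinearPMap.le_sSup _ hz⟩
    exact (hc hf).trans (LinearPMap.le_sSup _ hf)) f₀ (le_refl f₀)
  -- For `x` outside the domain, the restriction to `domain ∩ A x` extends to the cyclic module `A
  -- x`, and gluing would enlarge the maximal extension.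
  have htop : f.domain = ⊤ := by
    refine eq_top_iff.2 fun x _ => ?_
    let Z := Submodule.span A {x}
    have hZ : 𝒦 Z := h𝒦.of_injective Z.subtype Z.injective_subtype hY
    have hcyc : ∃ z : Z, Submodule.span A {z} = ⊤ :=
      ⟨⟨x, Submodule.mem_span_singleton_self x⟩, by
        refine Submodule.map_injective_of_injective Z.injective_subtype ?_
        rw [Submodule.map_span, Set.image_singleton, Submodule.map_top, Submodule.range_subtype]
        rfl⟩
    let N' : Submodule A Z := f.domain.comap Z.subtype
    obtain ⟨h, hh⟩ := hE hZ hcyc N' (f.toFun ∘ₗ (Z.subtype.restrict (fun z hz => hz)))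
    let f' : Y →ₗ.[A] E := ⟨Z, h⟩
    have hagree : ∀ (a : f.domain) (b : f'.domain), (a : Y) = b → f a = f' b := by
      intro a b hab
      have := hh ⟨b, show (b : Y) ∈ f.domain from hab ▸ a.2⟩
      refine Eq.trans ?_ this.symm
      exact congrArg f.toFun (Subtype.ext hab)
    have hle : f.sup f' hagree ≤ f :=
      hmax.2 (hf₀.trans (LinearPMap.left_le_sup f f' hagree)) (LinearPMap.left_le_sup f f' hagree)
    have := (LinearPMap.right_le_sup f f' hagree).trans hle
    exact this.1 (Submodule.mem_span_singleton_self x)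
  refine ⟨f.toFun ∘ₗ (LinearEquiv.ofTop f.domain htop).symm.toLinearMap, fun n => ?_⟩
  exact (hf₀.2 (x := n) (y := (LinearEquiv.ofTop f.domain htop).symm n) rfl).symm

end cyclicInjectivity

/-! ### Rational modules -/

/-- The data governing the rational modules of a ring `A` acting on a `(Q, P)`-bimodule `C`, where
`U` is the bimodule in which linear forms on `C` take their values. For right comodules of an
`R`-coring `C` one takes `Q = U = R`, `P = Rᵐᵒᵖ`, and `A` the ring of left colinear endomorphisms
of `C`. -/
structure RationalData (Q P U C A : Type u) [Ring Q] [Ring P] [Ring A] [AddCommGroup U]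
    [Module Q U] [Module P U] [AddCommGroup C] [Module Q C] [Module P C] [Module A C] where
  /-- the structure map of `A` -/
  φ : P →+* A
  φ_smul : ∀ (p : P) (c : C), φ p • c = p • c
  smul_comm : ∀ (a : A) (q : Q) (c : C), a • q • c = q • a • c
  /-- the counit -/
  ε : C →ₗ[Q] U
  ε_smul : ∀ (p : P) (c : C), ε (p • c) = p • ε c
  /-- the identification of `U` with `Q` -/
  σ : U →ₗ[Q] Q
  /-- the identification of `U` with `P` -/
  τ : U →ₗ[P] P
  τ_smul : ∀ u v : U, τ u • v = σ v • u
  exists_rep : ∀ f : C →ₗ[Q] U, ∃ a : A, ∀ c, ε (a • c) = f c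
  exists_dual_basis : ∀ F : Finset C, ∃ (n : ℕ) (x : Fin n → C) (f : Fin n → (C →ₗ[Q] U)),
    ∀ c ∈ F, c = ∑ k, σ (f k c) • x k

namespace RationalData

variable {Q P U C A : Type u} [Ring Q] [Ring P] [Ring A] [AddCommGroup U]
  [Module Q U] [Module P U] [AddCommGroup C] [Module Q C] [Module P C] [Module A C]
  (D : RationalData Q P U C A)

/-- `y` is rational if the map `a ↦ a y` is a sum of maps `a ↦ y' ε(a c)`. -/
def IsRationalElt {Y : Type u} [AddCommGroup Y] [Module A Y] (y : Y) : Prop :=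
  (fun a : A => a • y) ∈ AddSubgroup.closure
    {g : A → Y | ∃ (y' : Y) (c : C), g = fun a => D.φ (D.τ (D.ε (a • c))) • y'}

/-- A module is rational if all of its elements are. -/
def IsRational (Y : Type u) [AddCommGroup Y] [Module A Y] : Prop := ∀ y : Y, D.IsRationalElt y

variable {D}

theorem isRationalElt_of_sum {Y : Type u} [AddCommGroup Y] [Module A Y] {ι : Type*} [Fintype ι]
    {y : Y} (y' : ι → Y) (c : ι → C)
    (h : ∀ a : A, a • y = ∑ i, D.φ (D.τ (D.ε (a • c i))) • y' i) : D.IsRationalElt y := by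
  have : (fun a : A => a • y) = ∑ i, fun a : A => D.φ (D.τ (D.ε (a • c i))) • y' i := by
    ext a
    rw [h, Finset.sum_apply]
  rw [IsRationalElt, this]
  exact sum_mem fun i _ => AddSubgroup.subset_closure ⟨y' i, c i, rfl⟩

theorem IsRationalElt.exists_sum {Y : Type u} [AddCommGroup Y] [Module A Y] {y : Y}
    (hy : D.IsRationalElt y) : ∃ (ι : Type) (_ : Fintype ι) (y' : ι → Y) (c : ι → C),
      ∀ a : A, a • y = ∑ i, D.φ (D.τ (D.ε (a • c i))) • y' i := by
  have key : ∀ g ∈ AddSubgroup.closure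
      {g : A → Y | ∃ (y' : Y) (c : C), g = fun a => D.φ (D.τ (D.ε (a • c))) • y'},
      ∃ (ι : Type) (_ : Fintype ι) (y' : ι → Y) (c : ι → C),
        ∀ a : A, g a = ∑ i, D.φ (D.τ (D.ε (a • c i))) • y' i := by
    intro g hg
    induction hg using AddSubgroup.closure_induction with
    | mem g hg =>
      obtain ⟨y', c, rfl⟩ := hg
      exact ⟨Unit, inferInstance, fun _ => y', fun _ => c, fun a => by simp⟩
    | zero => exact ⟨Empty, inferInstance, Empty.elim, Empty.elim, fun a => by simp⟩
    | add g g' _ _ h h' =>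
      obtain ⟨ι, _, y, c, h⟩ := h
      obtain ⟨ι', _, y', c', h'⟩ := h'
      refine ⟨ι ⊕ ι', inferInstance, Sum.elim y y', Sum.elim c c', fun a => ?_⟩
      rw [Fintype.sum_sum_type, Pi.add_apply, h, h']
      rfl
    | neg g _ h =>
      obtain ⟨ι, _, y, c, h⟩ := h
      refine ⟨ι, inferInstance, fun i => -y i, c, fun a => ?_⟩
      rw [Pi.neg_apply, h, ← Finset.sum_neg_distrib]
      exact Finset.sum_congr rfl fun i _ => (smul_neg _ _).symm
  exact key _ hy

/-- The coefficients of a rational element can be taken in the submodule it generates. -/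
theorem IsRationalElt.exists_expansion {Y : Type u} [AddCommGroup Y] [Module A Y] {y : Y}
    (hy : D.IsRationalElt y) : ∃ (n : ℕ) (x : Fin n → C) (b : Fin n → A),
      ∀ a : A, a • y = ∑ k, D.φ (D.τ (D.ε (a • x k))) • b k • y := by
  classical
  obtain ⟨ι, _, y', c, h⟩ := hy.exists_sum
  obtain ⟨n, x, f, hf⟩ := D.exists_dual_basis (Finset.univ.image c)
  choose b hb using fun k => D.exists_rep (f k)
  refine ⟨n, x, b, fun a => ?_⟩
  -- Expand `c i` in the dual basis and write each form `f k` as `ε (b k • ·)`. After exchanging the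
  -- sums, the coefficient of `ε (a • x k)` is the expansion of `b k • y`.
  have hc : ∀ i, D.τ (D.ε (a • c i)) =
      ∑ k, D.τ (D.ε (a • x k)) * D.τ (D.ε (b k • c i)) := by
    intro i
    have h1 := hf (c i) (Finset.mem_image_of_mem c (Finset.mem_univ i))
    conv_lhs => rw [h1]
    rw [Finset.smul_sum, map_sum, map_sum]
    refine Finset.sum_congr rfl fun k _ => ?_
    rw [D.smul_comm, map_smul, ← D.τ_smul, map_smul, hb, smul_eq_mul]
  simp_rw [h, hc, map_sum, map_mul, Finset.sum_smul, Finset.smul_sum, mul_smul]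
  exact Finset.sum_comm

theorem IsRationalElt.add {Y : Type u} [AddCommGroup Y] [Module A Y] {y y' : Y}
    (h : D.IsRationalElt y) (h' : D.IsRationalElt y') : D.IsRationalElt (y + y') := by
  have := add_mem h h'
  rw [IsRationalElt]
  convert this using 1
  ext a
  simp

theorem IsRationalElt.zero {Y : Type u} [AddCommGroup Y] [Module A Y] :
    D.IsRationalElt (0 : Y) :=
  isRationalElt_of_sum (ι := Empty) Empty.elim Empty.elim (by simp)

theorem IsRationalElt.map {Y Z : Type u} [AddCommGroup Y] [Module A Y] [AddCommGroup Z]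
    [Module A Z] (f : Y →ₗ[A] Z) {y : Y} (h : D.IsRationalElt y) : D.IsRationalElt (f y) := by
  obtain ⟨ι, _, y', c, h⟩ := h.exists_sum
  exact isRationalElt_of_sum (fun i => f (y' i)) c fun a => by rw [← map_smul, h]; simp

/-! ### Finiteness of cyclic rational modules over the base ring -/

variable (D)

/-- Finite generation over the base ring. -/
def BaseFinite (Y : Type u) [AddCommGroup Y] [Module A Y] : Prop :=
  ∃ (n : ℕ) (g : Fin n → Y), ∀ y, ∃ p : Fin n → P, y = ∑ i, D.φ (p i) • g i

variable {D}

/-- The finiteness theorem: in the expansion of `a • y` only the coefficients from the base ring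
depend on `a`, so the finitely many `b k • y` generate. -/
theorem IsRational.baseFinite {Y : Type u} [AddCommGroup Y] [Module A Y] (hY : D.IsRational Y)
    (h : ∃ y : Y, Submodule.span A {y} = ⊤) : D.BaseFinite Y := by
  obtain ⟨y, hy⟩ := h
  obtain ⟨n, x, b, hx⟩ := (hY y).exists_expansion
  refine ⟨n, fun k => b k • y, fun z => ?_⟩
  obtain ⟨a, rfl⟩ := Submodule.mem_span_singleton.1 (hy ▸ Submodule.mem_top : z ∈ _)
  exact ⟨_, hx a⟩

theorem BaseFinite.finite {Y : Type u} [AddCommGroup Y] [Module A Y] (h : D.BaseFinite Y) :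
    letI := Module.compHom Y D.φ; Module.Finite P Y := by
  let := Module.compHom Y D.φ
  obtain ⟨n, g, hg⟩ := h
  refine Module.finite_def.2 ?_
  have : (⊤ : Submodule P Y) = Submodule.span P (Set.range g) := by
    refine (eq_top_iff.2 fun y _ => ?_).symm
    obtain ⟨p, rfl⟩ := hg y
    exact sum_mem fun i _ => Submodule.smul_mem _ (p i) (Submodule.subset_span ⟨i, rfl⟩)
  rw [this]
  exact Submodule.fg_span (Set.finite_range g)

theorem isNoetherian_of_compHom {Y : Type u} [AddCommGroup Y] [Module A Y] (φ : P →+* A)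
    (h : letI := Module.compHom Y φ; IsNoetherian P Y) : IsNoetherian A Y := by
  let := Module.compHom Y φ
  let := Module.compHom A φ
  have : IsScalarTower P A Y := ⟨fun p a y => mul_smul (φ p) a y⟩
  exact isNoetherian_of_tower P h

theorem isArtinian_of_compHom {Y : Type u} [AddCommGroup Y] [Module A Y] (φ : P →+* A)
    (h : letI := Module.compHom Y φ; IsArtinian P Y) : IsArtinian A Y := by
  let := Module.compHom Y φ
  let := Module.compHom A φ
  have : IsScalarTower P A Y := ⟨fun p a y => mul_smul (φ p) a y⟩
  exact isArtinian_of_tower P h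

theorem BaseFinite.submodule [IsNoetherianRing P] {Y : Type u} [AddCommGroup Y] [Module A Y]
    (h : D.BaseFinite Y) (N : Submodule A Y) : D.BaseFinite N := by
  let := Module.compHom Y D.φ
  let := Module.compHom N D.φ
  have := h.finite
  let i : N →ₗ[P] Y :=
    { toFun := Subtype.val, map_add' := fun _ _ => rfl, map_smul' := fun _ _ => rfl }
  have : IsNoetherian P N := isNoetherian_of_injective i Subtype.val_injective
  obtain ⟨n, g, hg⟩ := Module.Finite.exists_fin (R := P) (M := N)
  refine ⟨n, g, fun y => ?_⟩
  obtain ⟨p, hp⟩ := (Submodule.mem_span_range_iff_exists_fun P).1 (hg ▸ Submodule.mem_top : y ∈ _)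
  exact ⟨p, hp.symm⟩

/-- The coefficients `b k • f y` of the expansion already lie in the image of `f`; an arbitrary
representation of a rational element would not suffice here. -/
theorem IsRational.of_injective {Y Z : Type u} [AddCommGroup Y] [Module A Y] [AddCommGroup Z]
    [Module A Z] (hZ : D.IsRational Z) (f : Y →ₗ[A] Z) (hf : Function.Injective f) :
    D.IsRational Y := fun y => by
  obtain ⟨n, x, b, h⟩ := (hZ (f y)).exists_expansion
  refine isRationalElt_of_sum (fun k => b k • y) x fun a => hf ?_
  rw [map_smul, h, map_sum]
  simp only [map_smul]

theorem IsRational.baseFinite_span {Y : Type u} [AddCommGroup Y] [Module A Y]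
    (hY : D.IsRational Y) (y : Y) : D.BaseFinite (Submodule.span A {y}) := by
  refine (hY.of_injective (Submodule.span A {y}).subtype
    (Submodule.injective_subtype _)).baseFinite
    ⟨⟨y, Submodule.mem_span_singleton_self y⟩, ?_⟩
  refine Submodule.map_injective_of_injective (Submodule.injective_subtype _) ?_
  rw [Submodule.map_span, Set.image_singleton, Submodule.map_top, Submodule.range_subtype]
  rfl

variable (D)

theorem isLocallyFiniteClass [IsNoetherianRing P] [IsArtinianRing P] :
    IsLocallyFiniteClass D.IsRational where
  of_injective f hf hN := hN.of_injective f hf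
  of_surjective f hf hM m := by
    obtain ⟨m, rfl⟩ := hf m
    exact (hM m).map f
  dfinsupp M _ _ hM m := by
    classical
    induction m using DFinsupp.induction with
    | h0 => exact IsRationalElt.zero
    | ha i b f _ _ ih =>
      exact IsRationalElt.add ((hM i b).map (DFinsupp.lsingle i : M i →ₗ[A] Π₀ i, M i)) ih
  isNoetherian_span {M} _ _ hM m := by
    have := (hM.baseFinite_span m).finite
    let := Module.compHom (Submodule.span A {m}) D.φ
    exact isNoetherian_of_compHom D.φ inferInstance
  isArtinian_span {M} _ _ hM m := by
    have := (hM.baseFinite_span m).finite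
    let := Module.compHom (Submodule.span A {m}) D.φ
    exact isArtinian_of_compHom D.φ inferInstance

/-- The forms of a dual basis for `c - c'` all have the shape `ε (b • ·)`, so they vanish at `c -
c'`. -/
theorem eq_of_forall_ε {c c' : C} (h : ∀ a : A, D.ε (a • c) = D.ε (a • c')) : c = c' := by
  obtain ⟨n, x, f, hf⟩ := D.exists_dual_basis {c - c'}
  have h1 := hf _ (Finset.mem_singleton_self _)
  rw [← sub_eq_zero, h1]
  refine Finset.sum_eq_zero fun k _ => ?_
  obtain ⟨b, hb⟩ := D.exists_rep (f k)
  rw [← hb, smul_sub, map_sub, h, sub_self, map_zero, zero_smul]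

/-- Forms on a rational module correspond to `A`-linear maps to `C`. -/
theorem exists_linearMap {Y : Type u} [AddCommGroup Y] [Module A Y] (hY : D.IsRational Y)
    (f : Y →+ U) (hf : ∀ (p : P) (y : Y), f (D.φ p • y) = p • f y) :
    ∃ g : Y →ₗ[A] C, ∀ y, D.ε (g y) = f y := by
  -- If `y` is represented by `∑ y'_i ⊗ c_i`, the element `∑ f(y'_i) c_i` of `C` works. Its
  -- uniqueness makes the choice `A`-linear.
  have h1 : ∀ y, ∃ c : C, ∀ a : A, D.ε (a • c) = f (a • y) := by
    intro y
    obtain ⟨ι, _, y', c, h⟩ := (hY y).exists_sum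
    refine ⟨∑ i, D.σ (f (y' i)) • c i, fun a => ?_⟩
    rw [h, map_sum, Finset.smul_sum, map_sum]
    refine Finset.sum_congr rfl fun i _ => ?_
    rw [hf, D.smul_comm, map_smul, D.τ_smul]
  choose g hg using h1
  exact ⟨{ toFun := g
           map_add' := fun y y' => D.eq_of_forall_ε fun a => by
            rw [hg, smul_add, smul_add, map_add, map_add, hg, hg]
           map_smul' := fun b y => D.eq_of_forall_ε fun a => by
            rw [hg, RingHom.id_apply, smul_smul, smul_smul, hg] },
    fun y => by simpa using hg y 1⟩

/-- Compose `g` with `ε`, extend the resulting form from `N` to `Y` by injectivity of `U` over the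
base, and turn the extension back into a map to `C`. -/
theorem isClassInjective (hU : Module.Injective P U) :
    IsClassInjective D.IsRational C := by
  intro Y _ _ hY N g
  let := Module.compHom Y D.φ
  let := Module.compHom N D.φ
  let i : N →ₗ[P] Y :=
    { toFun := Subtype.val, map_add' := fun _ _ => rfl, map_smul' := fun _ _ => rfl }
  let f₀ : N →ₗ[P] U :=
    { toFun := fun n => D.ε (g n)
      map_add' := fun _ _ => by simp
      map_smul' := fun p n => by
        have : g (p • n) = D.φ p • g n := g.map_smul (D.φ p) n
        rw [this, D.φ_smul, D.ε_smul]; rfl }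
  obtain ⟨f, hf⟩ := hU.out i Subtype.val_injective f₀
  obtain ⟨h, hh⟩ := D.exists_linearMap hY f.toAddMonoidHom (fun p y => f.map_smul p y)
  refine ⟨h, fun n => D.eq_of_forall_ε fun a => ?_⟩
  rw [← map_smul, ← map_smul, hh]
  exact hf (a • n)

theorem exists_linearMap_ne_zero (hU : Module.Injective P U)
    (hK : ∀ (W : Type u) [AddCommGroup W] [Module P W] [IsSimpleModule P W],
      ∃ f : W →ₗ[P] U, f ≠ 0) {Y : Type u} [AddCommGroup Y] [Module A Y] [Nontrivial Y]
    (hY : D.IsRational Y) : ∃ g : Y →ₗ[A] C, g ≠ 0 := by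
  let := Module.compHom Y D.φ
  obtain ⟨y, hy⟩ := exists_ne (0 : Y)
  obtain ⟨f, hf⟩ := hU.exists_apply_ne_zero hK hy
  obtain ⟨g, hg⟩ := D.exists_linearMap hY f.toAddMonoidHom (fun p y => f.map_smul p y)
  refine ⟨g, fun h => hf ?_⟩
  have := hg y
  rw [h] at this
  simpa using this.symm

/-! ### The duality `Hom(-, C)` between the two sides -/

section duality

variable {D} {B : Type u} [Ring B] [Module B C] {D' : RationalData P Q U C B}

/-- A dual basis for the finitely many values of `g` at generators of `Y` serves all values of `g`,
as its forms are linear over the base. Writing these forms as `ε (b k • ·)`, one finds that `∑ (b k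
• g) ⊗ x k` represents `g`. -/
theorem BaseFinite.isRational_dual [SMulCommClass A B C] (hε : ∀ c, D'.ε c = D.ε c) {Y : Type u} [AddCommGroup Y]
    [Module A Y] (hY : D.BaseFinite Y) : D'.IsRational (Y →ₗ[A] C) := by
  classical
  intro g
  obtain ⟨m, z, hz⟩ := hY
  obtain ⟨n, x, f, hf⟩ := D'.exists_dual_basis (Finset.univ.image fun i => g (z i))
  choose b hb using fun k => D'.exists_rep (f k)
  have hgy : ∀ y, g y = ∑ k, D'.σ (f k (g y)) • x k := by
    intro y
    obtain ⟨p, rfl⟩ := hz y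
    have h1 : ∀ i, g (z i) = ∑ k, D'.σ (f k (g (z i))) • x k := fun i =>
      hf _ (Finset.mem_image_of_mem _ (Finset.mem_univ i))
    simp_rw [map_sum, map_smul, D.φ_smul, map_smul, Finset.sum_smul]
    rw [Finset.sum_comm]
    refine Finset.sum_congr rfl fun i _ => ?_
    conv_lhs => rw [h1 i]
    simp_rw [Finset.smul_sum, smul_assoc]
  refine isRationalElt_of_sum (fun k => b k • g) x fun c => LinearMap.ext fun y =>
    D.eq_of_forall_ε fun a => ?_
  rw [← map_smul, ← map_smul, ← hε, ← hε, LinearMap.smul_apply, LinearMap.sum_apply]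
  conv_lhs => rw [hgy (a • y)]
  rw [Finset.smul_sum, map_sum, map_sum]
  refine Finset.sum_congr rfl fun k _ => ?_
  rw [D'.smul_comm, map_smul, LinearMap.smul_apply, LinearMap.smul_apply, D'.φ_smul, D'.ε_smul,
    hb, D'.τ_smul]

/-- A `B`-linear map to `C` is determined by its composite with `ε`, hence by the values of the
latter at generators of `Y`. This embeds the dual in a finite power of the noetherian module `U`. -/
theorem BaseFinite.isNoetherian_dual [SMulCommClass B A C] [IsNoetherian P U] (hε : ∀ c, D'.ε c = D.ε c) {Y : Type u}
    [AddCommGroup Y] [Module B Y] (hY : D'.BaseFinite Y) : IsNoetherian A (Y →ₗ[B] C) := by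
  obtain ⟨m, z, hz⟩ := hY
  refine isNoetherian_of_compHom D.φ ?_
  let := Module.compHom (Y →ₗ[B] C) D.φ
  let Θ : (Y →ₗ[B] C) →ₗ[P] (Fin m → U) :=
    { toFun := fun g i => D.ε (g (z i))
      map_add' := fun g g' => by ext i; simp
      map_smul' := fun p g => by
        ext i
        have : (p • g) (z i) = D.φ p • g (z i) := rfl
        simp [this, D.φ_smul, D.ε_smul] }
  refine isNoetherian_of_injective Θ fun g g' h => LinearMap.ext fun y => D'.eq_of_forall_ε ?_
  intro b
  rw [← map_smul, ← map_smul]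
  obtain ⟨q, hq⟩ := hz (b • y)
  have h1 : ∀ i, D'.ε (g (z i)) = D'.ε (g' (z i)) := fun i => by
    rw [hε, hε]; exact congrFun h i
  rw [hq]
  simp [D'.φ_smul, D'.ε_smul, h1]

/-- By exchange of arguments, extending `N → Hom(Y, C)` to `X` is lifting `Y → Hom(N, C)` along the
restriction `Hom(X, C) → Hom(N, C)`. That restriction is onto because `C` is injective, and
projectivity of `Y` applies once both duals are rational. This is why `X` is first reduced to a
cyclic module. -/
theorem isClassInjective_dual [SMulCommClass A B C] [SMulCommClass B A C]
    [IsNoetherianRing P] [IsArtinianRing P]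
    (hU : Module.Injective P U) (hε : ∀ c, D'.ε c = D.ε c) {Y : Type u} [AddCommGroup Y]
    [Module B Y] (hY : IsClassProjective D'.IsRational Y) :
    IsClassInjective D.IsRational (Y →ₗ[B] C) := by
  refine D.isLocallyFiniteClass.isClassInjective_of_cyclic ?_
  intro X _ _ hX hcyc N g
  have hXf := hX.baseFinite hcyc
  let res : (X →ₗ[A] C) →ₗ[B] (N →ₗ[A] C) :=
    { toFun := fun h => h ∘ₗ N.subtype, map_add' := fun _ _ => rfl, map_smul' := fun _ _ => rfl }
  have hres : Function.Surjective res := fun k => by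
    obtain ⟨h, hh⟩ := D.isClassInjective hU hX N k
    exact ⟨h, LinearMap.ext hh⟩
  obtain ⟨h, hh⟩ := hY (hXf.isRational_dual hε) ((hXf.submodule N).isRational_dual hε) res hres
    g.flip
  refine ⟨h.flip, fun n => LinearMap.ext fun y => ?_⟩
  exact LinearMap.congr_fun (LinearMap.congr_fun hh y) n

/-- If the simple rational modules on one side have projective covers, then those on the other side
embed in noetherian injective modules. -/
theorem exists_injective_embedding [SMulCommClass A B C] [SMulCommClass B A C]
    [IsNoetherianRing P] [IsArtinianRing P] [IsNoetherianRing Q]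
    [IsArtinianRing Q] [IsNoetherian P U] (hU : Module.Injective P U)
    (hK : ∀ (W : Type u) [AddCommGroup W] [Module P W] [IsSimpleModule P W],
      ∃ f : W →ₗ[P] U, f ≠ 0)
    (hε : ∀ c, D'.ε c = D.ε c)
    (hcov : ∀ (T : Type u) [AddCommGroup T] [Module B T], D'.IsRational T → IsSimpleModule B T →
      HasClassCover D'.IsRational T)
    (S : Type u) [AddCommGroup S] [Module A S] (hS : D.IsRational S) (hS' : IsSimpleModule A S) :
    ∃ (E : Type u) (_ : AddCommGroup E) (_ : Module A E) (i : S →ₗ[A] E),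
      Function.Injective i ∧ IsNoetherian A E ∧
        IsClassInjective D.IsRational E := by
  have := IsSimpleModule.nontrivial A S
  obtain ⟨s, hs⟩ := exists_ne (0 : S)
  have hSf := hS.baseFinite ⟨s, IsSimpleModule.span_singleton_eq_top A hs⟩
  have hdual : D'.IsRational (S →ₗ[A] C) := hSf.isRational_dual hε
  -- The nonzero dual of `S` contains a cyclic `B`-module with a simple quotient. The cover `X` of
  -- that quotient lifts to a nonzero `X → Hom(S, C)`; exchanging arguments gives a nonzero, hence
  -- injective, `S → Hom(X, C)`.
  obtain ⟨d, hd⟩ := D.exists_linearMap_ne_zero hU hK hS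
  have h𝒦 := D'.isLocallyFiniteClass
  let N := Submodule.span B {d}
  have := h𝒦.isNoetherian_span hdual d
  have hN : D'.IsRational N := h𝒦.of_injective N.subtype N.injective_subtype hdual
  have : Nontrivial N := Submodule.nontrivial_iff_ne_bot.2 (by simpa [N] using hd)
  obtain ⟨K, hK', -⟩ := (eq_top_or_exists_le_coatom (⊥ : Submodule B N)).resolve_left bot_ne_top
  have hT := isSimpleModule_iff_isCoatom.2 hK'
  have hNK : D'.IsRational (N ⧸ K) := h𝒦.of_surjective K.mkQ K.mkQ_surjective hN
  obtain ⟨X, _, _, f, hX, hXP, hf, hsup⟩ := hcov (N ⧸ K) hNK hT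
  obtain ⟨g, hg⟩ := hXP hN hNK K.mkQ K.mkQ_surjective f
  let h : X →ₗ[B] (S →ₗ[A] C) := N.subtype ∘ₗ g
  have hne : h ≠ 0 := by
    intro h0
    have := IsSimpleModule.nontrivial B (N ⧸ K)
    obtain ⟨t, ht⟩ := exists_ne (0 : N ⧸ K)
    obtain ⟨x, rfl⟩ := hf t
    have h1 : g x = 0 := N.injective_subtype (by rw [map_zero]; exact LinearMap.congr_fun h0 x)
    rw [← hg, LinearMap.comp_apply, h1, map_zero] at ht
    exact ht rfl
  refine ⟨X →ₗ[B] C, inferInstance, inferInstance, h.flip, ?_,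
    (hX.baseFinite (span_eq_top_of_superfluous hf hsup)).isNoetherian_dual hε,
    isClassInjective_dual hU hε hXP⟩
  refine LinearMap.injective_of_ne_zero fun h0 => hne ?_
  ext x y
  exact LinearMap.congr_fun (LinearMap.congr_fun h0 y) x

/-- If the simple rational modules on both sides have projective covers, then all rational modules
have. -/
theorem hasClassCover [SMulCommClass A B C] [SMulCommClass B A C]
    [IsNoetherianRing P] [IsArtinianRing P] [IsNoetherianRing Q]
    [IsArtinianRing Q] [IsNoetherian P U] (hU : Module.Injective P U)
    (hK : ∀ (W : Type u) [AddCommGroup W] [Module P W] [IsSimpleModule P W],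
      ∃ f : W →ₗ[P] U, f ≠ 0)
    (hε : ∀ c, D'.ε c = D.ε c)
    (hcov' : ∀ (T : Type u) [AddCommGroup T] [Module B T], D'.IsRational T → IsSimpleModule B T →
      HasClassCover D'.IsRational T)
    (hcov : ∀ (T : Type u) [AddCommGroup T] [Module A T], D.IsRational T → IsSimpleModule A T →
      HasClassCover D.IsRational T)
    (M : Type u) [AddCommGroup M] [Module A M] (hM : D.IsRational M) :
    HasClassCover D.IsRational M :=
  D.isLocallyFiniteClass.hasClassCover hcov
    (fun S _ _ hS hS' => exists_injective_embedding hU hK hε hcov' S hS hS') M hM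

end duality

end RationalData

/-! ### Categories equivalent to a class of modules -/

section realization

variable {A : Type u} [Ring A] {𝒦 : ∀ (M : Type u) [AddCommGroup M] [Module A M], Prop}
  {𝒞 : Type v} [Category.{u} 𝒞] (G : 𝒞 ⥤ ModuleCat.{u} A) [G.Faithful]

theorem epi_of_surjective_map {M N : 𝒞} (f : M ⟶ N) (hf : Function.Surjective (G.map f)) :
    Epi f := by
  have := (ModuleCat.epi_iff_surjective (G.map f)).2 hf
  exact G.epi_of_epi_map this

variable [G.Full]

theorem isClassProjective_of_projective (hG' : ∀ (X : Type u) [AddCommGroup X] [Module A X], 𝒦 X →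
      ∃ M : 𝒞, Nonempty (X ≃ₗ[A] G.obj M)) (P : 𝒞) [Projective P] :
    IsClassProjective 𝒦 (G.obj P) := by
  intro Y Z _ _ _ _ hY hZ p hp g
  obtain ⟨Y', ⟨eY⟩⟩ := hG' Y hY
  obtain ⟨Z', ⟨eZ⟩⟩ := hG' Z hZ
  obtain ⟨p', hp'⟩ := G.map_surjective
    (ModuleCat.ofHom (eZ.toLinearMap ∘ₗ p ∘ₗ eY.symm.toLinearMap))
  obtain ⟨g', hg'⟩ := G.map_surjective (ModuleCat.ofHom (eZ.toLinearMap ∘ₗ g))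
  have : Epi p' := epi_of_surjective_map G p' (by
    rw [hp']
    exact eZ.surjective.comp (hp.comp eY.symm.surjective))
  have h1 := congrArg G.map (Projective.factorThru_comp g' p')
  rw [G.map_comp, hp', hg'] at h1
  refine ⟨eY.symm.toLinearMap ∘ₗ (G.map (Projective.factorThru g' p')).hom,
    LinearMap.ext fun x => eZ.injective ?_⟩
  exact congrArg (fun k => k.hom x) h1

variable [Limits.HasZeroMorphisms 𝒞] [G.PreservesZeroMorphisms]

/-- The cokernel of `G.map f` belongs to the class, so its projection comes from a morphism `q` with
`f ≫ q = 0`. Then `q = 0`, and the cokernel vanishes. -/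
theorem surjective_map_of_epi (h𝒦 : IsLocallyFiniteClass 𝒦) (hG : ∀ M, 𝒦 (G.obj M))
    (hG' : ∀ (X : Type u) [AddCommGroup X] [Module A X], 𝒦 X →
      ∃ M : 𝒞, Nonempty (X ≃ₗ[A] G.obj M)) {M N : 𝒞} (f : M ⟶ N) [Epi f] :
    Function.Surjective (G.map f) := by
  let L := LinearMap.range (G.map f).hom
  obtain ⟨Q, ⟨e⟩⟩ := hG' (G.obj N ⧸ L) (h𝒦.of_surjective L.mkQ L.mkQ_surjective (hG N))
  obtain ⟨q, hq⟩ := G.map_surjective (ModuleCat.ofHom (e.toLinearMap ∘ₗ L.mkQ))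
  have h0 : f ≫ q = f ≫ 0 := by
    apply G.map_injective
    ext m
    have : L.mkQ ((G.map f).hom m) = 0 :=
      (Submodule.Quotient.mk_eq_zero _).2 (LinearMap.mem_range_self _ m)
    rw [G.map_comp, hq, Limits.comp_zero, G.map_zero]
    change e (L.mkQ ((G.map f).hom m)) = 0
    rw [this, map_zero]
  have hq0 : q = 0 := (cancel_epi f).1 h0
  intro n
  rw [hq0, G.map_zero] at hq
  have : e (L.mkQ n) = 0 := (congrArg (fun g => g.hom n) hq).symm
  exact (Submodule.Quotient.mk_eq_zero L).1 (e.injective (this.trans (map_zero e).symm))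

/-- The kernel of `G.map f` is realized by an object, so a monomorphism `f` has injective image. If
`f` is nonzero, that image is also surjective onto the simple module. -/
theorem simple_of_isSimpleModule_obj (h𝒦 : IsLocallyFiniteClass 𝒦) (hG : ∀ M, 𝒦 (G.obj M))
    (hG' : ∀ (X : Type u) [AddCommGroup X] [Module A X], 𝒦 X →
      ∃ M : 𝒞, Nonempty (X ≃ₗ[A] G.obj M)) (S : 𝒞) [IsSimpleModule A (G.obj S)] :
    Simple S where
  mono_isIso_iff_nonzero {Y} f hf := by
    refine ⟨fun _ h0 => ?_, fun h0 => ?_⟩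
    · have := IsSimpleModule.nontrivial A (G.obj S)
      obtain ⟨s, hs⟩ := exists_ne (0 : G.obj S)
      have h1 : 𝟙 S = 0 := by
        rw [← IsIso.inv_hom_id f]
        exact (congrArg (inv f ≫ ·) h0).trans Limits.comp_zero
      have h2 : G.map (𝟙 S) = 0 := by rw [h1, G.map_zero]
      rw [G.map_id] at h2
      exact hs (congrArg (fun g => g.hom s) h2)
    · let L := LinearMap.ker (G.map f).hom
      obtain ⟨K, ⟨e⟩⟩ := hG' L (h𝒦.of_injective L.subtype L.injective_subtype (hG Y))
      obtain ⟨i, hi⟩ := G.map_surjective (ModuleCat.ofHom (L.subtype ∘ₗ e.symm.toLinearMap))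
      have h1 : i ≫ f = 0 ≫ f := by
        apply G.map_injective
        ext k
        rw [G.map_comp, hi, Limits.zero_comp, G.map_zero]
        exact (e.symm k).2
      have hi0 : i = 0 := (cancel_mono f).1 h1
      rw [hi0, G.map_zero] at hi
      have hinj : Function.Injective (G.map f).hom := by
        refine LinearMap.ker_eq_bot.1 ((Submodule.eq_bot_iff _).2 fun y hy => ?_)
        have := congrArg (fun g => g.hom (e ⟨y, hy⟩)) hi
        simpa using this.symm
      have hne : (G.map f).hom ≠ 0 := fun h => h0 (G.map_injective (by
        rw [G.map_zero]
        exact ModuleCat.hom_ext h))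
      have hsurj := LinearMap.surjective_of_ne_zero hne
      have : IsIso (G.map f) := (ConcreteCategory.isIso_iff_bijective (G.map f)).2 ⟨hinj, hsurj⟩
      exact isIso_of_reflects_iso f G

theorem projective_of_isClassProjective (h𝒦 : IsLocallyFiniteClass 𝒦) (hG : ∀ M, 𝒦 (G.obj M))
    (hG' : ∀ (X : Type u) [AddCommGroup X] [Module A X], 𝒦 X →
      ∃ M : 𝒞, Nonempty (X ≃ₗ[A] G.obj M)) (P : 𝒞) (hP : IsClassProjective 𝒦 (G.obj P)) :
    Projective P where
  factors {E X} f e _ := by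
    obtain ⟨h, hh⟩ := hP (hG E) (hG X) (G.map e).hom (surjective_map_of_epi G h𝒦 hG hG' e)
      (G.map f).hom
    obtain ⟨k, hk⟩ := G.map_surjective (ModuleCat.ofHom h)
    refine ⟨k, G.map_injective ?_⟩
    rw [G.map_comp, hk]
    exact ModuleCat.hom_ext hh

end realization

theorem IsClassProjective.of_linearEquiv {A : Type u} [Ring A]
    {𝒦 : ∀ (M : Type u) [AddCommGroup M] [Module A M], Prop} {P P' : Type u} [AddCommGroup P]
    [Module A P] [AddCommGroup P'] [Module A P'] (hP : IsClassProjective 𝒦 P) (e : P ≃ₗ[A] P') :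
    IsClassProjective 𝒦 P' := by
  intro Y Z _ _ _ _ hY hZ p hp g
  obtain ⟨h, hh⟩ := hP hY hZ p hp (g ∘ₗ e.toLinearMap)
  refine ⟨h ∘ₗ e.symm.toLinearMap, ?_⟩
  rw [← LinearMap.comp_assoc, hh]
  ext x
  simp

/-! ### Slicing balanced tensors by linear forms -/

namespace BalTensor

section slices

variable {R : Type u} [Ring R] {M : Type v} {N : Type w} [AddCommGroup M] [Module Rᵐᵒᵖ M]
  [AddCommGroup N] [Module R N]

theorem induction_on {p : BalTensor R M N → Prop} (t : BalTensor R M N) (zero : p 0)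
    (tmul : ∀ m n, p (tmul R m n)) (add : ∀ x y, p x → p y → p (x + y)) : p t := by
  obtain ⟨t, rfl⟩ := QuotientAddGroup.mk'_surjective (BalTensor.relations R M N) t
  induction t using TensorProduct.induction_on with
  | zero => rw [map_zero]; exact zero
  | tmul m n => exact tmul m n
  | add x y hx hy => rw [map_add]; exact add _ _ hx hy

theorem tmul_sum {ι : Type*} (s : Finset ι) (m : M) (n : ι → N) :
    tmul R m (∑ i ∈ s, n i) = ∑ i ∈ s, tmul R m (n i) :=
  map_sum (AddMonoidHom.mk' (tmul R m) (tmul_add R m)) n s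

theorem sum_tmul {ι : Type*} (s : Finset ι) (m : ι → M) (n : N) :
    tmul R (∑ i ∈ s, m i) n = ∑ i ∈ s, tmul R (m i) n :=
  map_sum (AddMonoidHom.mk' (fun m => tmul R m n) (fun m m' => add_tmul R m m' n)) m s

theorem map_map {M' M'' N' N'' : Type*} [AddCommGroup M'] [Module Rᵐᵒᵖ M'] [AddCommGroup N']
    [Module R N'] [AddCommGroup M''] [Module Rᵐᵒᵖ M''] [AddCommGroup N''] [Module R N'']
    (f' : M' →ₗ[Rᵐᵒᵖ] M'') (f : M →ₗ[Rᵐᵒᵖ] M') (g' : N' →ₗ[R] N'') (g : N →ₗ[R] N')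
    (t : BalTensor R M N) : map R f' g' (map R f g t) = map R (f' ∘ₗ f) (g' ∘ₗ g) t :=
  DFunLike.congr_fun (hom_ext R (f := (map R f' g').comp (map R f g))
    (g := map R (f' ∘ₗ f) (g' ∘ₗ g)) fun _ _ => rfl) t

theorem map_id_id (t : BalTensor R M N) :
    map R (LinearMap.id : M →ₗ[Rᵐᵒᵖ] M) (LinearMap.id : N →ₗ[R] N) t = t :=
  DFunLike.congr_fun (hom_ext R (f := map R LinearMap.id LinearMap.id)
    (g := AddMonoidHom.id (BalTensor R M N)) fun _ _ => rfl) t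

theorem map_add_right {M' N' : Type*} [AddCommGroup M'] [Module Rᵐᵒᵖ M'] [AddCommGroup N']
    [Module R N'] (f : M →ₗ[Rᵐᵒᵖ] M') (g g' : N →ₗ[R] N') (t : BalTensor R M N) :
    map R f (g + g') t = map R f g t + map R f g' t :=
  DFunLike.congr_fun (hom_ext R (f := map R f (g + g'))
    (g := map R f g + map R f g') fun m n => by
      simp only [map_tmul, LinearMap.add_apply, tmul_add, AddMonoidHom.add_apply]) t

theorem map_add_left {M' N' : Type*} [AddCommGroup M'] [Module Rᵐᵒᵖ M'] [AddCommGroup N']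
    [Module R N'] (f f' : M →ₗ[Rᵐᵒᵖ] M') (g : N →ₗ[R] N') (t : BalTensor R M N) :
    map R (f + f') g t = map R f g t + map R f' g t :=
  DFunLike.congr_fun (hom_ext R (f := map R (f + f') g)
    (g := map R f g + map R f' g) fun m n => by
      simp only [map_tmul, LinearMap.add_apply, add_tmul, AddMonoidHom.add_apply]) t

/-- The map `m ⊗ n ↦ m f(n)`. -/
def sliceRight (M : Type v) [AddCommGroup M] [Module Rᵐᵒᵖ M] (f : N →ₗ[R] R) :
    BalTensor R M N →+ M :=
  (rid R M).comp (map R LinearMap.id f)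

/-- The map `m ⊗ n ↦ f(m) n`. -/
def sliceLeft (N : Type w) [AddCommGroup N] [Module R N] (f : M →ₗ[Rᵐᵒᵖ] R) :
    BalTensor R M N →+ N :=
  (lid R N).comp (map R f LinearMap.id)

@[simp]
theorem sliceRight_tmul (f : N →ₗ[R] R) (m : M) (n : N) :
    sliceRight M f (tmul R m n) = MulOpposite.op (f n) • m := rfl

@[simp]
theorem sliceLeft_tmul (f : M →ₗ[Rᵐᵒᵖ] R) (m : M) (n : N) :
    sliceLeft N f (tmul R m n) = f m • n := rfl

theorem sliceRight_add (f g : N →ₗ[R] R) (t : BalTensor R M N) :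
    sliceRight M (f + g) t = sliceRight M f t + sliceRight M g t := by
  simp only [sliceRight, AddMonoidHom.comp_apply, map_add_right, map_add]

theorem sliceLeft_add (f g : M →ₗ[Rᵐᵒᵖ] R) (t : BalTensor R M N) :
    sliceLeft N (f + g) t = sliceLeft N f t + sliceLeft N g t := by
  simp only [sliceLeft, AddMonoidHom.comp_apply, map_add_left, map_add]

theorem sliceRight_map {M' N' : Type*} [AddCommGroup M'] [Module Rᵐᵒᵖ M'] [AddCommGroup N']
    [Module R N'] (f : M →ₗ[Rᵐᵒᵖ] M') (g : N →ₗ[R] N') (h : N' →ₗ[R] R) (t : BalTensor R M N) :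
    sliceRight M' h (map R f g t) = f (sliceRight M (h ∘ₗ g) t) :=
  DFunLike.congr_fun (hom_ext R (f := (sliceRight M' h).comp (map R f g))
    (g := f.toAddMonoidHom.comp (sliceRight M (h ∘ₗ g))) fun m n => by simp) t

theorem sliceLeft_map {M' N' : Type*} [AddCommGroup M'] [Module Rᵐᵒᵖ M'] [AddCommGroup N']
    [Module R N'] (f : M →ₗ[Rᵐᵒᵖ] M') (g : N →ₗ[R] N') (h : M' →ₗ[Rᵐᵒᵖ] R)
    (t : BalTensor R M N) : sliceLeft N' h (map R f g t) = g (sliceLeft N (h ∘ₗ f) t) :=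
  DFunLike.congr_fun (hom_ext R (f := (sliceLeft N' h).comp (map R f g))
    (g := g.toAddMonoidHom.comp (sliceLeft N (h ∘ₗ f))) fun m n => by simp) t

/-- `sliceRight` as a left linear map, on a bimodule. -/
def sliceRightₗ (M : Type v) [AddCommGroup M] [Module Rᵐᵒᵖ M] [Module R M] [SMulCommClass R Rᵐᵒᵖ M]
    (f : N →ₗ[R] R) : BalTensor R M N →ₗ[R] M :=
  { sliceRight M f with
    map_smul' := fun r t => DFunLike.congr_fun (hom_ext R
      (f := (sliceRight M f).comp (DistribSMul.toAddMonoidHom (BalTensor R M N) r))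
      (g := (DistribSMul.toAddMonoidHom M r).comp (sliceRight M f)) fun m n => by
        simp [smul_tmul, smul_comm]) t }

/-- `sliceLeft` as a right linear map, on a bimodule. -/
def sliceLeftₗ (N : Type w) [AddCommGroup N] [Module R N] [Module Rᵐᵒᵖ N] [SMulCommClass R Rᵐᵒᵖ N]
    (f : M →ₗ[Rᵐᵒᵖ] R) : BalTensor R M N →ₗ[Rᵐᵒᵖ] N :=
  { sliceLeft N f with
    map_smul' := fun r t => DFunLike.congr_fun (hom_ext R
      (f := (sliceLeft N f).comp (DistribSMul.toAddMonoidHom (BalTensor R M N) r))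
      (g := (DistribSMul.toAddMonoidHom N r).comp (sliceLeft N f)) fun m n => by
        simp [op_smul_tmul_right, smul_comm]) t }

/-- `F` collects the right-hand factors of a representation of `t`. Asking for the identity with
every dual basis of `F` lets sums be handled by uniting the two sets. -/
theorem exists_eq_sum_tmul_right (t : BalTensor R M N) :
    ∃ F : Finset N, ∀ (n : ℕ) (x : Fin n → N) (f : Fin n → (N →ₗ[R] R)),
      (∀ c ∈ F, c = ∑ k, f k c • x k) → t = ∑ k, tmul R (sliceRight M (f k) t) (x k) := by
  classical
  induction t using induction_on with
  | zero =>
    refine ⟨∅, fun n x f _ => (Finset.sum_eq_zero fun k _ => ?_).symm⟩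
    rw [map_zero]
    simpa using add_tmul R (0 : M) 0 (x k)
  | tmul m c =>
    refine ⟨{c}, fun n x f h => ?_⟩
    simp_rw [sliceRight_tmul, op_smul_tmul, ← tmul_sum]
    rw [← h c (Finset.mem_singleton_self c)]
  | add s t hs ht =>
    obtain ⟨F, hF⟩ := hs
    obtain ⟨F', hF'⟩ := ht
    refine ⟨F ∪ F', fun n x f h => ?_⟩
    simp_rw [map_add, add_tmul, Finset.sum_add_distrib]
    rw [← hF n x f fun c hc => h c (Finset.mem_union_left _ hc),
      ← hF' n x f fun c hc => h c (Finset.mem_union_right _ hc)]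

theorem exists_eq_sum_tmul_left (t : BalTensor R M N) :
    ∃ F : Finset M, ∀ (n : ℕ) (x : Fin n → M) (f : Fin n → (M →ₗ[Rᵐᵒᵖ] R)),
      (∀ c ∈ F, c = ∑ k, MulOpposite.op (f k c) • x k) →
        t = ∑ k, tmul R (x k) (sliceLeft N (f k) t) := by
  classical
  induction t using induction_on with
  | zero =>
    refine ⟨∅, fun n x f _ => (Finset.sum_eq_zero fun k _ => ?_).symm⟩
    rw [map_zero]
    simpa using tmul_add R (x k) (0 : N) 0
  | tmul c m =>
    refine ⟨{c}, fun n x f h => ?_⟩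
    simp_rw [sliceLeft_tmul, ← op_smul_tmul, ← sum_tmul]
    rw [← h c (Finset.mem_singleton_self c)]
  | add s t hs ht =>
    obtain ⟨F, hF⟩ := hs
    obtain ⟨F', hF'⟩ := ht
    refine ⟨F ∪ F', fun n x f h => ?_⟩
    simp_rw [map_add, tmul_add, Finset.sum_add_distrib]
    rw [← hF n x f fun c hc => h c (Finset.mem_union_left _ hc),
      ← hF' n x f fun c hc => h c (Finset.mem_union_right _ hc)]

end slices

end BalTensor

/-! ### Right comodules as rational modules -/

namespace BalTensor

variable {R : Type u} [Ring R] {M N L : Type*} [AddCommGroup M] [Module Rᵐᵒᵖ M]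
  [AddCommGroup N] [Module R N] [Module Rᵐᵒᵖ N] [SMulCommClass R Rᵐᵒᵖ N]
  [AddCommGroup L] [Module R L]

theorem map_sliceRightₗ_assoc (g : L →ₗ[R] R) (t : BalTensor R (BalTensor R M N) L) :
    map R LinearMap.id (sliceRightₗ N g) (assoc R M N L t) =
      sliceRight (BalTensor R M N) g t :=
  DFunLike.congr_fun (hom_ext R
    (f := (map R LinearMap.id (sliceRightₗ N g)).comp (assoc R M N L))
    (g := sliceRight (BalTensor R M N) g) fun t c =>
      DFunLike.congr_fun (hom_ext R
        (f := ((map R LinearMap.id (sliceRightₗ N g)).comp (assoc R M N L)).comp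
          (AddMonoidHom.mk' (fun t => tmul R t c) fun t t' => add_tmul R t t' c))
        (g := (DistribSMul.toAddMonoidHom (BalTensor R M N) (MulOpposite.op (g c))))
        fun _ _ => rfl) t) t

theorem sliceRight_assoc (f : N →ₗ[R] R) (g : L →ₗ[R] R)
    (t : BalTensor R (BalTensor R M N) L) :
    sliceRight M (f ∘ₗ sliceRightₗ N g) (assoc R M N L t) =
      sliceRight M f (sliceRight (BalTensor R M N) g t) := by
  rw [← map_sliceRightₗ_assoc, sliceRight_map, LinearMap.id_apply]

/-- Right multiplication on a bimodule, as a left linear map. -/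
def rightMul (R N : Type*) [Ring R] [AddCommGroup N] [Module R N] [Module Rᵐᵒᵖ N]
    [SMulCommClass R Rᵐᵒᵖ N] (r : Rᵐᵒᵖ) : N →ₗ[R] N where
  toFun n := r • n
  map_add' := smul_add r
  map_smul' s n := (smul_comm s r n).symm

theorem op_smul_eq_map (r : Rᵐᵒᵖ) (t : BalTensor R M N) :
    r • t = map R LinearMap.id (rightMul R N r) t := by
  induction t using induction_on with
  | zero => rw [smul_zero, map_zero]
  | tmul m n => rw [op_smul_tmul_right]; rfl
  | add s t hs ht => rw [smul_add, map_add, hs, ht]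

theorem sliceRight_op_smul (f : N →ₗ[R] R) (r : Rᵐᵒᵖ) (t : BalTensor R M N) :
    sliceRight M f (r • t) = sliceRight M (f ∘ₗ rightMul R N r) t := by
  rw [op_smul_eq_map, sliceRight_map, LinearMap.id_apply]

/-- Linear forms on a locally projective module separate the elements of a tensor product. -/
theorem eq_zero_of_sliceRight (hL : IsLocallyProjective R L) {t : BalTensor R M L}
    (h : ∀ f : L →ₗ[R] R, sliceRight M f t = 0) : t = 0 := by
  obtain ⟨F, hF⟩ := exists_eq_sum_tmul_right t
  obtain ⟨n, x, f, hx⟩ := hL F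
  rw [hF n x f hx]
  refine Finset.sum_eq_zero fun k _ => ?_
  rw [h]
  simpa using add_tmul R (0 : M) 0 (x k)

/-- A dual basis for the entries of `t` in `L` rebuilds `t` from its slices along the last factor.
This serves to check coassociativity inside `M ⊗ (N ⊗ L)`, without inverting `assoc`. -/
theorem eq_zero_of_map_sliceRightₗ (hL : IsLocallyProjective R L)
    {t : BalTensor R M (BalTensor R N L)}
    (h : ∀ f : L →ₗ[R] R, map R (LinearMap.id : M →ₗ[Rᵐᵒᵖ] M) (sliceRightₗ N f) t = 0) :
    t = 0 := by
  classical
  let ins : L → (N →ₗ[R] BalTensor R N L) := fun x =>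
    { toFun := fun z => tmul R z x
      map_add' := fun z z' => add_tmul R z z' x
      map_smul' := fun r z => (smul_tmul R r z x).symm }
  have key : ∃ F : Finset L, ∀ (n : ℕ) (x : Fin n → L) (f : Fin n → (L →ₗ[R] R)),
      (∀ c ∈ F, c = ∑ k, f k c • x k) →
        t = ∑ k, map R (LinearMap.id : M →ₗ[Rᵐᵒᵖ] M) (ins (x k))
          (map R LinearMap.id (sliceRightₗ N (f k)) t) := by
    clear h
    induction t using induction_on with
    | zero => exact ⟨∅, fun n x f _ => by simp⟩
    | tmul m u =>
      obtain ⟨F, hF⟩ := exists_eq_sum_tmul_right u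
      refine ⟨F, fun n x f hx => ?_⟩
      simp_rw [map_tmul, ← tmul_sum]
      conv_lhs => rw [hF n x f hx]
      rfl
    | add s t hs ht =>
      obtain ⟨F, hF⟩ := hs
      obtain ⟨F', hF'⟩ := ht
      refine ⟨F ∪ F', fun n x f h => ?_⟩
      simp_rw [map_add, Finset.sum_add_distrib]
      rw [← hF n x f fun c hc => h c (Finset.mem_union_left _ hc),
        ← hF' n x f fun c hc => h c (Finset.mem_union_right _ hc)]
  obtain ⟨F, hF⟩ := key
  obtain ⟨n, x, f, hx⟩ := hL F
  rw [hF n x f hx]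
  exact Finset.sum_eq_zero fun k _ => by rw [h, map_zero]

end BalTensor

/-! ### Left colinear endomorphisms of `C` and their action on right comodules -/

section rightComodules

open BalTensor CoringStruct

variable (R C : Type u) [Ring R] [AddCommGroup C] [Module R C] [Module Rᵐᵒᵖ C]
  [SMulCommClass R Rᵐᵒᵖ C] [Coring R C]

/-- The ring of left colinear endomorphisms of `C`. -/
def leftColinearEnd : Subring (Module.End R C) where
  carrier := {θ | ∀ c, comulL (R := R) (θ c) = map R LinearMap.id θ (comulL c)}
  mul_mem' {θ η} hθ hη c := by
    rw [Module.End.mul_apply, hθ, hη, map_map]; rfl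
  one_mem' c := (map_id_id _).symm
  add_mem' {θ η} hθ hη c := by
    rw [LinearMap.add_apply, map_add, hθ, hη, map_add_right]
  zero_mem' c := by
    have h := map_add_right (LinearMap.id : C →ₗ[Rᵐᵒᵖ] C) (0 : C →ₗ[R] C) 0 (comulL (R := R) c)
    rw [add_zero, left_eq_add] at h
    rw [h, LinearMap.zero_apply, map_zero]
  neg_mem' {θ} hθ c := by
    have h := map_add_right (LinearMap.id : C →ₗ[Rᵐᵒᵖ] C) θ (-θ) (comulL (R := R) c)
    have h0 := map_add_right (LinearMap.id : C →ₗ[Rᵐᵒᵖ] C) (0 : C →ₗ[R] C) 0 (comulL (R := R) c)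
    rw [add_zero, left_eq_add] at h0
    rw [add_neg_cancel, h0, ← hθ] at h
    rw [LinearMap.neg_apply, map_neg]
    exact neg_eq_of_add_eq_zero_right h.symm

variable {R C}

theorem leftColinearEnd_comul (θ : leftColinearEnd R C) (c : C) :
    comulL (R := R) (θ.1 c) = map R LinearMap.id θ.1 (comulL c) := θ.2 c

/-- Apply the counit to the right factor of `Δ(θ c) = c₁ ⊗ θ(c₂)`. So `θ` is recovered from the form
`ε ∘ θ`. -/
theorem leftColinearEnd_apply (θ : leftColinearEnd R C) (c : C) :
    θ.1 c = sliceRight C (counitL ∘ₗ θ.1) (comulL (R := R) c) := by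
  have h := Coring.comul_counit (R := R) (θ.1 c)
  rw [leftColinearEnd_comul, map_map] at h
  exact h.symm

theorem leftColinearEnd_eq_comp (θ : leftColinearEnd R C) :
    θ.1 = sliceRightₗ C (counitL ∘ₗ θ.1) ∘ₗ comulL :=
  LinearMap.ext (leftColinearEnd_apply θ)

variable (R C) in
/-- The left colinear endomorphism `c ↦ c₁ f(c₂)`. -/
def leftColinearEndOfForm (f : C →ₗ[R] R) : leftColinearEnd R C :=
  ⟨sliceRightₗ C f ∘ₗ comulL, fun c => by
    have h := map_map (LinearMap.id : C →ₗ[Rᵐᵒᵖ] C) LinearMap.id (sliceRightₗ C f)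
      (comulL (R := R) (C := C)) (comulL (R := R) c)
    rw [LinearMap.id_comp] at h
    rw [← h, ← Coring.coassoc, map_sliceRightₗ_assoc, sliceRight_map, LinearMap.comp_id]
    rfl⟩

/-- `ε(c₁ f(c₂)) = ε(c₁) f(c₂) = f(ε(c₁) c₂) = f(c)`. Every form thus arises as `ε ∘ θ`. -/
theorem counitL_leftColinearEndOfForm (f : C →ₗ[R] R) (c : C) :
    counitL (R := R) ((leftColinearEndOfForm R C f).1 c) = f c := by
  have h : ∀ t : BalTensor R C C, counitL (R := R) (sliceRight C f t) =
      f (sliceLeft C (counitR R C) t) := fun t =>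
    DFunLike.congr_fun (hom_ext R
      (f := (counitL (R := R) (C := C)).toAddMonoidHom.comp (sliceRight C f))
      (g := f.toAddMonoidHom.comp (sliceLeft C (counitR R C))) fun m n => by
        simp only [AddMonoidHom.comp_apply, sliceRight_tmul, sliceLeft_tmul,
          LinearMap.toAddMonoidHom_coe, counitL_op_smul, map_smul]
        rfl) t
  have h' := Coring.counit_comul (R := R) c
  exact (h (comulL c)).trans (congrArg f h')

variable (R C) in
/-- The right action of `R` on `C`, by left colinear endomorphisms. -/
def leftColinearEndOfBase : Rᵐᵒᵖ →+* leftColinearEnd R C where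
  toFun r :=
    ⟨rightMul R C r, fun c => (comulL_op_smul r c).trans (op_smul_eq_map r (comulL c))⟩
  map_one' := Subtype.ext (LinearMap.ext fun c => one_smul _ c)
  map_mul' r s := Subtype.ext (LinearMap.ext fun c => mul_smul r s c)
  map_zero' := Subtype.ext (LinearMap.ext fun c => zero_smul _ c)
  map_add' r s := Subtype.ext (LinearMap.ext fun c => add_smul r s c)

/-- The data governing right comodules. -/
def rightRationalData (hleft : IsLocallyProjective R C) :
    RationalData R Rᵐᵒᵖ R C (leftColinearEnd R C) where
  φ := leftColinearEndOfBase R C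
  φ_smul _ _ := rfl
  smul_comm a q c := a.1.map_smul q c
  ε := counitL
  ε_smul := counitL_op_smul
  σ := LinearMap.id
  τ := (MulOpposite.opLinearEquiv Rᵐᵒᵖ : R ≃ₗ[Rᵐᵒᵖ] Rᵐᵒᵖ).toLinearMap
  τ_smul _ _ := rfl
  exists_rep f := ⟨leftColinearEndOfForm R C f, counitL_leftColinearEndOfForm f⟩
  exists_dual_basis := hleft

namespace RightComod

/-- Coassociativity paired with `f` and `g`; the form `c ↦ f(c₁ g(c₂))` is their convolution
product, which becomes composition of endomorphisms. -/
theorem sliceRight_coact (M : RightComod R C) (f g : C →ₗ[R] R) (m : M.carrier) :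
    sliceRight M.carrier f (M.coact (sliceRight M.carrier g (M.coact m))) =
      sliceRight M.carrier (f ∘ₗ sliceRightₗ C g ∘ₗ comulL) (M.coact m) := by
  have h := sliceRight_map (R := R) M.coact (LinearMap.id : C →ₗ[R] C) g (M.coact m)
  rw [LinearMap.comp_id] at h
  rw [← h, ← sliceRight_assoc, M.coassoc, sliceRight_map]
  rfl

/-- The action is `θ m = m₀ ε(θ m₁)`. Counitality gives the unit law and coassociativity the product
law. -/
instance instModuleLeftColinearEnd (M : RightComod R C) :
    Module (leftColinearEnd R C) M.carrier where
  smul θ m := sliceRight M.carrier (counitL ∘ₗ θ.1) (M.coact m)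
  one_smul m := M.counit m
  mul_smul θ η m := by
    refine Eq.trans ?_ (M.sliceRight_coact _ _ m).symm
    rw [← leftColinearEnd_eq_comp]
    rfl
  smul_zero θ := by
    change sliceRight M.carrier (counitL ∘ₗ θ.1) (M.coact 0) = 0
    rw [map_zero, map_zero]
  smul_add θ m m' := by
    change sliceRight M.carrier (counitL ∘ₗ θ.1) (M.coact (m + m')) = _
    rw [map_add, map_add]; rfl
  add_smul θ η m := by
    change sliceRight M.carrier (counitL ∘ₗ (θ.1 + η.1)) (M.coact m) = _
    rw [LinearMap.comp_add, sliceRight_add]; rfl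
  zero_smul m := by
    change sliceRight M.carrier (counitL ∘ₗ (0 : C →ₗ[R] C)) (M.coact m) = 0
    have h := sliceRight_add (0 : C →ₗ[R] R) 0 (M.coact m)
    rw [add_zero, left_eq_add] at h
    rw [LinearMap.comp_zero, h]

theorem smul_def (M : RightComod R C) (θ : leftColinearEnd R C) (m : M.carrier) :
    θ • m = sliceRight M.carrier (counitL ∘ₗ θ.1) (M.coact m) := rfl

theorem ofBase_smul (M : RightComod R C) (r : Rᵐᵒᵖ) (m : M.carrier) :
    leftColinearEndOfBase R C r • m = r • m := by
  refine (sliceRight_op_smul counitL r (M.coact m)).symm.trans ?_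
  rw [← map_smul]
  exact M.counit (r • m)

theorem isRational (hleft : IsLocallyProjective R C) (M : RightComod R C) :
    (rightRationalData hleft).IsRational M.carrier := by
  intro m
  have key : ∀ t : BalTensor R M.carrier C, (fun θ : leftColinearEnd R C =>
      sliceRight M.carrier (counitL ∘ₗ θ.1) t) ∈ AddSubgroup.closure
        {g : leftColinearEnd R C → M.carrier | ∃ (y' : M.carrier) (c : C), g = fun a =>
          (rightRationalData hleft).φ ((rightRationalData hleft).τ
            ((rightRationalData hleft).ε (a • c))) • y'} := by
    intro t
    induction t using induction_on with
    | zero => simp only [map_zero]; exact zero_mem _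
    | tmul m c =>
      refine AddSubgroup.subset_closure ⟨m, c, funext fun θ => ?_⟩
      exact (M.ofBase_smul _ m).symm
    | add s t hs ht => simp only [map_add]; exact add_mem hs ht
  exact key (M.coact m)

/-- Colinear maps are linear over the ring of left colinear endomorphisms of `C`. -/
def Hom.toLinearMap {M N : RightComod R C} (f : Hom M N) :
    M.carrier →ₗ[leftColinearEnd R C] N.carrier where
  toFun := f.lin
  map_add' := map_add _
  map_smul' θ m := by
    rw [RingHom.id_apply, smul_def, smul_def, f.colinear, sliceRight_map, LinearMap.comp_id]

theorem eq_of_sliceRight (hleft : IsLocallyProjective R C) {X : Type*} [AddCommGroup X]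
    [Module Rᵐᵒᵖ X] {s t : BalTensor R X C}
    (h : ∀ θ : leftColinearEnd R C, sliceRight X (counitL ∘ₗ θ.1) s =
      sliceRight X (counitL ∘ₗ θ.1) t) : s = t := by
  refine sub_eq_zero.1 (eq_zero_of_sliceRight hleft fun f => ?_)
  have hf : counitL ∘ₗ (leftColinearEndOfForm R C f).1 = f :=
    LinearMap.ext (counitL_leftColinearEndOfForm f)
  rw [← hf, map_sub, h, sub_self]

/-- Linear maps over the ring of left colinear endomorphisms of `C` are colinear. -/
def Hom.ofLinearMap (hleft : IsLocallyProjective R C) {M N : RightComod R C}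
    (f : M.carrier →ₗ[leftColinearEnd R C] N.carrier) : Hom M N where
  lin :=
    { toFun := f
      map_add' := map_add f
      map_smul' := fun r m => by
        rw [← ofBase_smul, map_smul, ofBase_smul]; rfl }
  colinear m := eq_of_sliceRight hleft fun θ => by
    rw [sliceRight_map, LinearMap.comp_id]
    exact (f.map_smul θ m).symm

/-- Right comodules as modules over the ring of left colinear endomorphisms of `C`. -/
def toModuleCat : RightComod R C ⥤ ModuleCat.{u} (leftColinearEnd R C) where
  obj M := ModuleCat.of _ M.carrier
  map f := ModuleCat.ofHom (Hom.toLinearMap f)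

instance : (toModuleCat (R := R) (C := C)).Faithful where
  map_injective h := Hom.ext (LinearMap.ext fun m => congrArg (fun k => k.hom m) h)

instance : (toModuleCat (R := R) (C := C)).PreservesZeroMorphisms where
  map_zero _ _ := rfl

theorem full_toModuleCat (hleft : IsLocallyProjective R C) :
    (toModuleCat (R := R) (C := C)).Full where
  map_surjective f := ⟨Hom.ofLinearMap hleft f.hom, rfl⟩

/-- A representation `∑ y_i ⊗ c_i` of a rational element is a candidate for its coaction. Forms on
`C` separate tensors, so the candidate is unique and depends linearly on the element. -/
theorem exists_coact (hleft : IsLocallyProjective R C) {X : Type u} [AddCommGroup X]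
    [Module Rᵐᵒᵖ X] [Module (leftColinearEnd R C) X]
    (hX : ∀ (r : Rᵐᵒᵖ) (x : X), leftColinearEndOfBase R C r • x = r • x)
    (h : (rightRationalData hleft).IsRational X) :
    ∃ ρ : X →ₗ[Rᵐᵒᵖ] BalTensor R X C, ∀ (θ : leftColinearEnd R C) (x : X),
      sliceRight X (counitL ∘ₗ θ.1) (ρ x) = θ • x := by
  have h1 : ∀ x, ∃ t : BalTensor R X C, ∀ θ : leftColinearEnd R C,
      sliceRight X (counitL ∘ₗ θ.1) t = θ • x := by
    intro x
    obtain ⟨ι, _, y, c, hx⟩ := (h x).exists_sum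
    refine ⟨∑ i, tmul R (y i) (c i), fun θ => ?_⟩
    rw [hx, map_sum]
    exact Finset.sum_congr rfl fun i _ => (hX _ _).symm
  choose ρ hρ using h1
  refine ⟨{ toFun := ρ, map_add' := fun x y => ?_, map_smul' := fun r x => ?_ }, fun θ x => hρ x θ⟩
  · exact eq_of_sliceRight hleft fun θ => by rw [hρ, smul_add, map_add, hρ, hρ]
  · refine eq_of_sliceRight hleft fun θ => ?_
    rw [RingHom.id_apply, sliceRight_op_smul, hρ, ← hX, smul_smul, ← hρ]
    rfl

/-- Rational modules are right comodules. -/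
theorem exists_linearEquiv (hleft : IsLocallyProjective R C) (X : Type u) [AddCommGroup X]
    [Module (leftColinearEnd R C) X] (h : (rightRationalData hleft).IsRational X) :
    ∃ M : RightComod R C, Nonempty (X ≃ₗ[leftColinearEnd R C] toModuleCat.obj M) := by
  let := Module.compHom X (leftColinearEndOfBase R C)
  obtain ⟨ρ, hρ⟩ := exists_coact hleft (fun _ _ => rfl) h
  let M : RightComod R C :=
    { carrier := X
      coact := ρ
      coassoc := fun x => by
        -- Slicing the last factor by `g` and the remaining one by `ε ∘ θ` reduces coassociativity
        -- to associativity of the action on `x`.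
        refine sub_eq_zero.1 (eq_zero_of_map_sliceRightₗ hleft fun g => ?_)
        have h1 := sliceRight_map (R := R) ρ (LinearMap.id : C →ₗ[R] C) g (ρ x)
        have hg : counitL ∘ₗ (leftColinearEndOfForm R C g).1 = g :=
          LinearMap.ext (counitL_leftColinearEndOfForm g)
        rw [map_sub, map_sliceRightₗ_assoc, h1, map_map, LinearMap.comp_id, LinearMap.comp_id,
          sub_eq_zero]
        refine eq_of_sliceRight hleft fun θ => ?_
        rw [sliceRight_map, hρ]
        conv_lhs => rw [← hg, hρ, smul_smul, ← hρ]
        rfl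
      counit := fun x => (hρ 1 x).trans (one_smul _ x) }
  exact ⟨M, ⟨{ LinearEquiv.refl ℤ X with map_smul' := fun θ x => (hρ θ x).symm }⟩⟩

end RightComod

end rightComodules

/-! ### Subcomodules and transport of projective covers -/

section rightCovers

open BalTensor CoringStruct

variable {R C : Type u} [Ring R] [AddCommGroup C] [Module R C] [Module Rᵐᵒᵖ C]
  [SMulCommClass R Rᵐᵒᵖ C] [Coring R C]

namespace RightComod

/-- The underlying right `R`-submodule of a submodule over the ring of left colinear
endomorphisms. -/
def baseSubmodule {M : RightComod R C} (N : Submodule (leftColinearEnd R C) M.carrier) :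
    Submodule Rᵐᵒᵖ M.carrier where
  carrier := N
  add_mem' := N.add_mem
  zero_mem' := N.zero_mem
  smul_mem' r m hm := by
    rw [← ofBase_smul]
    exact N.smul_mem _ hm

/-- With a dual basis `(x k, f k)` the coaction of `m` is a sum of `m' ⊗ x k`, where `m'` is the
slice of `m` by `f k`, that is, an element of `A m`. Together with `IsSubcomodule.smul_mem` this
matches the two notions of smallness. -/
theorem isSubcomodule_baseSubmodule (hleft : IsLocallyProjective R C) {M : RightComod R C}
    (N : Submodule (leftColinearEnd R C) M.carrier) : M.IsSubcomodule (baseSubmodule N) := by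
  intro m hm
  obtain ⟨F, hF⟩ := exists_eq_sum_tmul_right (M.coact m)
  obtain ⟨n, x, f, hx⟩ := hleft F
  rw [hF n x f hx]
  refine sum_mem fun k _ => ?_
  have hk : sliceRight M.carrier (f k) (M.coact m) ∈ baseSubmodule N := by
    have hf : counitL ∘ₗ (leftColinearEndOfForm R C (f k)).1 = f k :=
      LinearMap.ext (counitL_leftColinearEndOfForm (f k))
    rw [← hf]
    exact N.smul_mem (leftColinearEndOfForm R C (f k)) hm
  exact ⟨tmul R ⟨_, hk⟩ (x k), rfl⟩

theorem IsSubcomodule.smul_mem {M : RightComod R C} {L : Submodule Rᵐᵒᵖ M.carrier}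
    (hL : M.IsSubcomodule L) (θ : leftColinearEnd R C) {m : M.carrier} (hm : m ∈ L) :
    θ • m ∈ L := by
  obtain ⟨t, ht⟩ := hL m hm
  rw [smul_def, ← ht, sliceRight_map]
  exact Submodule.coe_mem _

theorem hasClassCover_of_isSimpleModule (hleft : IsLocallyProjective R C)
    [IsNoetherianRing Rᵐᵒᵖ] [IsArtinianRing Rᵐᵒᵖ]
    (h : IsRightSemiperfectCoring R C) (T : Type u) [AddCommGroup T]
    [Module (leftColinearEnd R C) T] (hT : (rightRationalData hleft).IsRational T)
    (hT' : IsSimpleModule (leftColinearEnd R C) T) :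
    HasClassCover (rightRationalData hleft).IsRational T := by
  have := full_toModuleCat hleft
  have h𝒦 := (rightRationalData hleft).isLocallyFiniteClass
  obtain ⟨M, ⟨e⟩⟩ := exists_linearEquiv hleft T hT
  have := IsSimpleModule.congr e.symm
  have hM := simple_of_isSimpleModule_obj toModuleCat h𝒦 (isRational hleft)
    (exists_linearEquiv hleft) M
  obtain ⟨P, f, hP, hf, hsmall⟩ := h M hM
  refine ⟨P.carrier, inferInstance, inferInstance,
    e.symm.toLinearMap ∘ₗ (toModuleCat.map f).hom, P.isRational hleft,
    isClassProjective_of_projective toModuleCat (exists_linearEquiv hleft) P,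
    e.symm.surjective.comp (surjective_map_of_epi toModuleCat h𝒦 (isRational hleft)
    (exists_linearEquiv hleft) f), fun L hL => ?_⟩
  have h1 := hsmall (baseSubmodule L) (isSubcomodule_baseSubmodule hleft L)
    (eq_top_iff.2 fun x _ => by
      obtain ⟨y, hy, z, hz, rfl⟩ := Submodule.mem_sup.1 (hL ▸ Submodule.mem_top : x ∈ _)
      refine Submodule.add_mem_sup ?_ hz
      exact e.symm.injective ((LinearMap.mem_ker.1 hy).trans (map_zero e.symm).symm))
  exact eq_top_iff.2 fun x _ => (h1 ▸ Submodule.mem_top : x ∈ baseSubmodule L)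

theorem hasProjectiveCover_of_hasClassCover (hleft : IsLocallyProjective R C)
    [IsNoetherianRing Rᵐᵒᵖ] [IsArtinianRing Rᵐᵒᵖ] (M : RightComod R C)
    (h : HasClassCover (rightRationalData hleft).IsRational M.carrier) :
    M.HasProjectiveCover := by
  have := full_toModuleCat hleft
  have h𝒦 := (rightRationalData hleft).isLocallyFiniteClass
  obtain ⟨X, _, _, f, hX, hXP, hf, hsmall⟩ := h
  obtain ⟨P, ⟨e'⟩⟩ := exists_linearEquiv hleft X hX
  let e : X ≃ₗ[leftColinearEnd R C] P.carrier := e'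
  let g : P ⟶ M := Hom.ofLinearMap hleft (f ∘ₗ e.symm.toLinearMap)
  refine ⟨P, g, projective_of_isClassProjective toModuleCat h𝒦 (isRational hleft)
    (exists_linearEquiv hleft) P (hXP.of_linearEquiv e'),
    epi_of_surjective_map toModuleCat g (hf.comp e.symm.surjective), fun L hL hKL => ?_⟩
  let L' : Submodule (leftColinearEnd R C) X :=
    { carrier := {x | e x ∈ L}
      add_mem' := fun {x y} hx hy => by
        change e (x + y) ∈ L
        rw [map_add]; exact L.add_mem hx hy
      zero_mem' := by
        change e 0 ∈ L
        rw [map_zero]; exact L.zero_mem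
      smul_mem' := fun θ x hx => by
        change e (θ • x) ∈ L
        rw [map_smul]; exact hL.smul_mem θ hx }
  have h1 := hsmall L' (eq_top_iff.2 fun x _ => by
    obtain ⟨y, hy, z, hz, hyz⟩ := Submodule.mem_sup.1 (hKL ▸ Submodule.mem_top : e x ∈ _)
    refine Submodule.mem_sup.2 ⟨e.symm y, hy, e.symm z, ?_, ?_⟩
    · change e (e.symm z) ∈ L
      rwa [e.apply_symm_apply]
    · rw [← map_add]
      exact e.symm_apply_eq.2 hyz)
  refine eq_top_iff.2 fun x _ => ?_
  have : e.symm x ∈ L' := h1 ▸ Submodule.mem_top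
  have h2 : e (e.symm x) ∈ L := this
  rwa [e.apply_symm_apply] at h2

end RightComod

end rightCovers

/-! ### Left comodules as rational modules -/

/-- Dual bases of a locally projective right module, in terms of forms with values in `R`. -/
theorem IsLocallyProjective.exists_dual_basis_right {R : Type u} {M : Type v} [Ring R]
    [AddCommGroup M] [Module Rᵐᵒᵖ M] (h : IsLocallyProjective Rᵐᵒᵖ M) (F : Finset M) :
    ∃ (n : ℕ) (x : Fin n → M) (f : Fin n → (M →ₗ[Rᵐᵒᵖ] R)),
      ∀ m ∈ F, m = ∑ k, MulOpposite.op (f k m) • x k := by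
  obtain ⟨n, x, f, hf⟩ := h F
  exact ⟨n, x, fun k => (MulOpposite.opLinearEquiv Rᵐᵒᵖ : R ≃ₗ[Rᵐᵒᵖ] Rᵐᵒᵖ).symm.toLinearMap ∘ₗ f k,
    hf⟩

namespace BalTensor

variable {R : Type u} [Ring R] {M N L : Type*} [AddCommGroup M] [Module Rᵐᵒᵖ M]
  [AddCommGroup N] [Module R N] [Module Rᵐᵒᵖ N] [SMulCommClass R Rᵐᵒᵖ N]
  [AddCommGroup L] [Module R L]

theorem sliceLeft_assoc (g : M →ₗ[Rᵐᵒᵖ] R) (t : BalTensor R (BalTensor R M N) L) :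
    sliceLeft (BalTensor R N L) g (assoc R M N L t) =
      map R (sliceLeftₗ N g) LinearMap.id t :=
  DFunLike.congr_fun (hom_ext R
    (f := (sliceLeft (BalTensor R N L) g).comp (assoc R M N L))
    (g := map R (sliceLeftₗ N g) LinearMap.id) fun t c =>
      DFunLike.congr_fun (hom_ext R
        (f := ((sliceLeft (BalTensor R N L) g).comp (assoc R M N L)).comp
          (AddMonoidHom.mk' (fun t => tmul R t c) fun t t' => add_tmul R t t' c))
        (g := (map R (sliceLeftₗ N g) LinearMap.id).comp
          (AddMonoidHom.mk' (fun t => tmul R t c) fun t t' => add_tmul R t t' c))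
        fun _ _ => rfl) t) t

/-- Left multiplication on a bimodule, as a right linear map. -/
def leftMul (R N : Type*) [Ring R] [AddCommGroup N] [Module R N] [Module Rᵐᵒᵖ N]
    [SMulCommClass R Rᵐᵒᵖ N] (r : R) : N →ₗ[Rᵐᵒᵖ] N where
  toFun n := r • n
  map_add' := smul_add r
  map_smul' s n := smul_comm r s n

theorem smul_eq_map (r : R) (t : BalTensor R N L) :
    r • t = map R (leftMul R N r) LinearMap.id t := by
  induction t using induction_on with
  | zero => rw [smul_zero, map_zero]
  | tmul m n => rw [smul_tmul]; rfl
  | add s t hs ht => rw [smul_add, map_add, hs, ht]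

theorem sliceLeft_smul (f : N →ₗ[Rᵐᵒᵖ] R) (r : R) (t : BalTensor R N L) :
    sliceLeft L f (r • t) = sliceLeft L (f ∘ₗ leftMul R N r) t := by
  rw [smul_eq_map, sliceLeft_map, LinearMap.id_apply]

theorem eq_zero_of_sliceLeft (hM : IsLocallyProjective Rᵐᵒᵖ M) {t : BalTensor R M L}
    (h : ∀ f : M →ₗ[Rᵐᵒᵖ] R, sliceLeft L f t = 0) : t = 0 := by
  obtain ⟨F, hF⟩ := exists_eq_sum_tmul_left t
  obtain ⟨n, x, f, hx⟩ := hM.exists_dual_basis_right F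
  rw [hF n x f hx]
  refine Finset.sum_eq_zero fun k _ => ?_
  rw [h]
  simpa using tmul_add R (x k) (0 : L) 0

end BalTensor

/-! ### Right colinear endomorphisms of `C` and their action on left comodules -/

section leftComodules

open BalTensor CoringStruct

variable (R C : Type u) [Ring R] [AddCommGroup C] [Module R C] [Module Rᵐᵒᵖ C]
  [SMulCommClass R Rᵐᵒᵖ C] [Coring R C]

/-- The ring of right colinear endomorphisms of `C`. -/
def rightColinearEnd : Subring (Module.End Rᵐᵒᵖ C) where
  carrier := {θ | ∀ c, comulL (R := R) (θ c) = map R θ LinearMap.id (comulL c)}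
  mul_mem' {θ η} hθ hη c := by
    rw [Module.End.mul_apply, hθ, hη, map_map]; rfl
  one_mem' c := (map_id_id _).symm
  add_mem' {θ η} hθ hη c := by
    rw [LinearMap.add_apply, map_add, hθ, hη, map_add_left]
  zero_mem' c := by
    have h := map_add_left (0 : C →ₗ[Rᵐᵒᵖ] C) 0 (LinearMap.id : C →ₗ[R] C) (comulL (R := R) c)
    rw [add_zero, left_eq_add] at h
    rw [h, LinearMap.zero_apply, map_zero]
  neg_mem' {θ} hθ c := by
    have h := map_add_left θ (-θ) (LinearMap.id : C →ₗ[R] C) (comulL (R := R) c)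
    have h0 := map_add_left (0 : C →ₗ[Rᵐᵒᵖ] C) 0 (LinearMap.id : C →ₗ[R] C) (comulL (R := R) c)
    rw [add_zero, left_eq_add] at h0
    rw [add_neg_cancel, h0, ← hθ] at h
    rw [LinearMap.neg_apply, map_neg]
    exact neg_eq_of_add_eq_zero_right h.symm

variable {R C}

theorem rightColinearEnd_comul (θ : rightColinearEnd R C) (c : C) :
    comulL (R := R) (θ.1 c) = map R θ.1 LinearMap.id (comulL c) := θ.2 c

theorem rightColinearEnd_apply (θ : rightColinearEnd R C) (c : C) :
    θ.1 c = sliceLeft C (counitR R C ∘ₗ θ.1) (comulL (R := R) c) := by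
  have h := Coring.counit_comul (R := R) (θ.1 c)
  rw [rightColinearEnd_comul, map_map] at h
  exact h.symm

theorem rightColinearEnd_eq_comp (θ : rightColinearEnd R C) :
    θ.1 = sliceLeftₗ C (counitR R C ∘ₗ θ.1) ∘ₗ comulR R C :=
  LinearMap.ext (rightColinearEnd_apply θ)

variable (R C) in
/-- The right colinear endomorphism `c ↦ f(c₁) c₂`. -/
def rightColinearEndOfForm (f : C →ₗ[Rᵐᵒᵖ] R) : rightColinearEnd R C :=
  ⟨sliceLeftₗ C f ∘ₗ comulR R C, fun c => by
    have h := map_map (sliceLeftₗ C f) (comulR R C) (LinearMap.id : C →ₗ[R] C) LinearMap.id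
      (comulL (R := R) c)
    rw [LinearMap.id_comp] at h
    rw [← h, ← sliceLeft_assoc, Coring.coassoc, sliceLeft_map, LinearMap.comp_id]
    rfl⟩

theorem counitR_rightColinearEndOfForm (f : C →ₗ[Rᵐᵒᵖ] R) (c : C) :
    counitR R C ((rightColinearEndOfForm R C f).1 c) = f c := by
  have h : ∀ t : BalTensor R C C, counitR R C (sliceLeft C f t) =
      f (sliceRight C counitL t) := fun t =>
    DFunLike.congr_fun (hom_ext R
      (f := (counitR R C).toAddMonoidHom.comp (sliceLeft C f))
      (g := f.toAddMonoidHom.comp (sliceRight C counitL)) fun m n => by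
        simp only [AddMonoidHom.comp_apply, sliceRight_tmul, sliceLeft_tmul,
          LinearMap.toAddMonoidHom_coe, map_smul]
        exact map_smul (counitL (R := R) (C := C)) (f m) n) t
  have h' := Coring.comul_counit (R := R) c
  exact (h (comulL c)).trans (congrArg f h')

variable (R C) in
/-- The left action of `R` on `C`, by right colinear endomorphisms. -/
def rightColinearEndOfBase : R →+* rightColinearEnd R C where
  toFun r :=
    ⟨leftMul R C r, fun c => (map_smul comulL r c).trans (smul_eq_map r (comulL c))⟩
  map_one' := Subtype.ext (LinearMap.ext fun c => one_smul _ c)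
  map_mul' r s := Subtype.ext (LinearMap.ext fun c => mul_smul r s c)
  map_zero' := Subtype.ext (LinearMap.ext fun c => zero_smul _ c)
  map_add' r s := Subtype.ext (LinearMap.ext fun c => add_smul r s c)

/-- The data governing left comodules. -/
def leftRationalData (hright : IsLocallyProjective Rᵐᵒᵖ C) :
    RationalData Rᵐᵒᵖ R R C (rightColinearEnd R C) where
  φ := rightColinearEndOfBase R C
  φ_smul _ _ := rfl
  smul_comm a q c := a.1.map_smul q c
  ε := counitR R C
  ε_smul r c := map_smul (counitL (R := R) (C := C)) r c
  σ := (MulOpposite.opLinearEquiv Rᵐᵒᵖ : R ≃ₗ[Rᵐᵒᵖ] Rᵐᵒᵖ).toLinearMap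
  τ := LinearMap.id
  τ_smul _ _ := rfl
  exists_rep f := ⟨rightColinearEndOfForm R C f, counitR_rightColinearEndOfForm f⟩
  exists_dual_basis := hright.exists_dual_basis_right

namespace LeftComod

theorem sliceLeft_coact (M : LeftComod R C) (f g : C →ₗ[Rᵐᵒᵖ] R) (m : M.carrier) :
    sliceLeft M.carrier f (M.coact (sliceLeft M.carrier g (M.coact m))) =
      sliceLeft M.carrier (f ∘ₗ sliceLeftₗ C g ∘ₗ comulR R C) (M.coact m) := by
  have h := sliceLeft_map (R := R) (LinearMap.id : C →ₗ[Rᵐᵒᵖ] C) M.coact g (M.coact m)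
  rw [LinearMap.comp_id] at h
  rw [← h, ← M.coassoc, sliceLeft_assoc, sliceLeft_map, sliceLeft_map]
  rfl

instance instModuleRightColinearEnd (M : LeftComod R C) :
    Module (rightColinearEnd R C) M.carrier where
  smul θ m := sliceLeft M.carrier (counitR R C ∘ₗ θ.1) (M.coact m)
  one_smul m := M.counit m
  mul_smul θ η m := by
    refine Eq.trans ?_ (M.sliceLeft_coact _ _ m).symm
    rw [← rightColinearEnd_eq_comp]
    rfl
  smul_zero θ := by
    change sliceLeft M.carrier (counitR R C ∘ₗ θ.1) (M.coact 0) = 0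
    rw [map_zero, map_zero]
  smul_add θ m m' := by
    change sliceLeft M.carrier (counitR R C ∘ₗ θ.1) (M.coact (m + m')) = _
    rw [map_add, map_add]; rfl
  add_smul θ η m := by
    change sliceLeft M.carrier (counitR R C ∘ₗ (θ.1 + η.1)) (M.coact m) = _
    rw [LinearMap.comp_add, sliceLeft_add]; rfl
  zero_smul m := by
    change sliceLeft M.carrier (counitR R C ∘ₗ (0 : C →ₗ[Rᵐᵒᵖ] C)) (M.coact m) = 0
    have h := sliceLeft_add (0 : C →ₗ[Rᵐᵒᵖ] R) 0 (M.coact m)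
    rw [add_zero, left_eq_add] at h
    rw [LinearMap.comp_zero, h]

theorem smul_def (M : LeftComod R C) (θ : rightColinearEnd R C) (m : M.carrier) :
    θ • m = sliceLeft M.carrier (counitR R C ∘ₗ θ.1) (M.coact m) := rfl

theorem ofBase_smul (M : LeftComod R C) (r : R) (m : M.carrier) :
    rightColinearEndOfBase R C r • m = r • m := by
  refine (sliceLeft_smul (counitR R C) r (M.coact m)).symm.trans ?_
  rw [← map_smul]
  exact M.counit (r • m)

theorem isRational (hright : IsLocallyProjective Rᵐᵒᵖ C) (M : LeftComod R C) :
    (leftRationalData hright).IsRational M.carrier := by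
  intro m
  have key : ∀ t : BalTensor R C M.carrier, (fun θ : rightColinearEnd R C =>
      sliceLeft M.carrier (counitR R C ∘ₗ θ.1) t) ∈ AddSubgroup.closure
        {g : rightColinearEnd R C → M.carrier | ∃ (y' : M.carrier) (c : C), g = fun a =>
          (leftRationalData hright).φ ((leftRationalData hright).τ
            ((leftRationalData hright).ε (a • c))) • y'} := by
    intro t
    induction t using induction_on with
    | zero => simp only [map_zero]; exact zero_mem _
    | tmul c m =>
      refine AddSubgroup.subset_closure ⟨m, c, funext fun θ => ?_⟩
      exact (M.ofBase_smul _ m).symm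
    | add s t hs ht => simp only [map_add]; exact add_mem hs ht
  exact key (M.coact m)

/-- Colinear maps are linear over the ring of right colinear endomorphisms of `C`. -/
def Hom.toLinearMap {M N : LeftComod R C} (f : Hom M N) :
    M.carrier →ₗ[rightColinearEnd R C] N.carrier where
  toFun := f.lin
  map_add' := map_add _
  map_smul' θ m := by
    rw [RingHom.id_apply, smul_def, smul_def, f.colinear, sliceLeft_map, LinearMap.comp_id]

theorem eq_of_sliceLeft (hright : IsLocallyProjective Rᵐᵒᵖ C) {X : Type*} [AddCommGroup X]
    [Module R X] {s t : BalTensor R C X}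
    (h : ∀ θ : rightColinearEnd R C, sliceLeft X (counitR R C ∘ₗ θ.1) s =
      sliceLeft X (counitR R C ∘ₗ θ.1) t) : s = t := by
  refine sub_eq_zero.1 (eq_zero_of_sliceLeft hright fun f => ?_)
  have hf : counitR R C ∘ₗ (rightColinearEndOfForm R C f).1 = f :=
    LinearMap.ext (counitR_rightColinearEndOfForm f)
  rw [← hf, map_sub, h, sub_self]

/-- Linear maps over the ring of right colinear endomorphisms of `C` are colinear. -/
def Hom.ofLinearMap (hright : IsLocallyProjective Rᵐᵒᵖ C) {M N : LeftComod R C}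
    (f : M.carrier →ₗ[rightColinearEnd R C] N.carrier) : Hom M N where
  lin :=
    { toFun := f
      map_add' := map_add f
      map_smul' := fun r m => by
        rw [← ofBase_smul, map_smul, ofBase_smul]; rfl }
  colinear m := eq_of_sliceLeft hright fun θ => by
    rw [sliceLeft_map, LinearMap.comp_id]
    exact (f.map_smul θ m).symm

/-- Left comodules as modules over the ring of right colinear endomorphisms of `C`. -/
def toModuleCat : LeftComod R C ⥤ ModuleCat.{u} (rightColinearEnd R C) where
  obj M := ModuleCat.of _ M.carrier
  map f := ModuleCat.ofHom (Hom.toLinearMap f)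

instance : (toModuleCat (R := R) (C := C)).Faithful where
  map_injective h := Hom.ext (LinearMap.ext fun m => congrArg (fun k => k.hom m) h)

instance : (toModuleCat (R := R) (C := C)).PreservesZeroMorphisms where
  map_zero _ _ := rfl

theorem full_toModuleCat (hright : IsLocallyProjective Rᵐᵒᵖ C) :
    (toModuleCat (R := R) (C := C)).Full where
  map_surjective f := ⟨Hom.ofLinearMap hright f.hom, rfl⟩

theorem exists_coact (hright : IsLocallyProjective Rᵐᵒᵖ C) {X : Type u} [AddCommGroup X]
    [Module R X] [Module (rightColinearEnd R C) X]
    (hX : ∀ (r : R) (x : X), rightColinearEndOfBase R C r • x = r • x)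
    (h : (leftRationalData hright).IsRational X) :
    ∃ ρ : X →ₗ[R] BalTensor R C X, ∀ (θ : rightColinearEnd R C) (x : X),
      sliceLeft X (counitR R C ∘ₗ θ.1) (ρ x) = θ • x := by
  have h1 : ∀ x, ∃ t : BalTensor R C X, ∀ θ : rightColinearEnd R C,
      sliceLeft X (counitR R C ∘ₗ θ.1) t = θ • x := by
    intro x
    obtain ⟨ι, _, y, c, hx⟩ := (h x).exists_sum
    refine ⟨∑ i, tmul R (c i) (y i), fun θ => ?_⟩
    rw [hx, map_sum]
    exact Finset.sum_congr rfl fun i _ => (hX _ _).symm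
  choose ρ hρ using h1
  refine ⟨{ toFun := ρ, map_add' := fun x y => ?_, map_smul' := fun r x => ?_ }, fun θ x => hρ x θ⟩
  · exact eq_of_sliceLeft hright fun θ => by rw [hρ, smul_add, map_add, hρ, hρ]
  · refine eq_of_sliceLeft hright fun θ => ?_
    rw [RingHom.id_apply, sliceLeft_smul, hρ, ← hX, smul_smul, ← hρ]
    rfl

/-- Rational modules are left comodules. -/
theorem exists_linearEquiv (hright : IsLocallyProjective Rᵐᵒᵖ C) (X : Type u) [AddCommGroup X]
    [Module (rightColinearEnd R C) X] (h : (leftRationalData hright).IsRational X) :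
    ∃ M : LeftComod R C, Nonempty (X ≃ₗ[rightColinearEnd R C] toModuleCat.obj M) := by
  let := Module.compHom X (rightColinearEndOfBase R C)
  obtain ⟨ρ, hρ⟩ := exists_coact hright (fun _ _ => rfl) h
  let M : LeftComod R C :=
    { carrier := X
      coact := ρ
      coassoc := fun x => by
        -- Here the first factor of `C ⊗ (C ⊗ X)` is the outer one, so ordinary slicing suffices
        -- where right comodules needed slices inside the second factor.
        refine sub_eq_zero.1 (eq_zero_of_sliceLeft hright fun g => ?_)
        have h1 := sliceLeft_map (R := R) (LinearMap.id : C →ₗ[Rᵐᵒᵖ] C) ρ g (ρ x)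
        have hg : counitR R C ∘ₗ (rightColinearEndOfForm R C g).1 = g :=
          LinearMap.ext (counitR_rightColinearEndOfForm g)
        rw [map_sub, sliceLeft_assoc, h1, map_map, LinearMap.comp_id, LinearMap.comp_id,
          sub_eq_zero]
        refine eq_of_sliceLeft hright fun θ => ?_
        rw [sliceLeft_map, hρ]
        conv_rhs => rw [← hg, hρ, smul_smul, ← hρ]
        rfl
      counit := fun x => (hρ 1 x).trans (one_smul _ x) }
  exact ⟨M, ⟨{ LinearEquiv.refl ℤ X with map_smul' := fun θ x => (hρ θ x).symm }⟩⟩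

/-- The underlying left `R`-submodule of a submodule over the ring of right colinear
endomorphisms. -/
def baseSubmodule {M : LeftComod R C} (N : Submodule (rightColinearEnd R C) M.carrier) :
    Submodule R M.carrier where
  carrier := N
  add_mem' := N.add_mem
  zero_mem' := N.zero_mem
  smul_mem' r m hm := by
    rw [← ofBase_smul]
    exact N.smul_mem _ hm

theorem isSubcomodule_baseSubmodule (hright : IsLocallyProjective Rᵐᵒᵖ C) {M : LeftComod R C}
    (N : Submodule (rightColinearEnd R C) M.carrier) : M.IsSubcomodule (baseSubmodule N) := by
  intro m hm
  obtain ⟨F, hF⟩ := exists_eq_sum_tmul_left (M.coact m)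
  obtain ⟨n, x, f, hx⟩ := hright.exists_dual_basis_right F
  rw [hF n x f hx]
  refine sum_mem fun k _ => ?_
  have hk : sliceLeft M.carrier (f k) (M.coact m) ∈ baseSubmodule N := by
    have hf : counitR R C ∘ₗ (rightColinearEndOfForm R C (f k)).1 = f k :=
      LinearMap.ext (counitR_rightColinearEndOfForm (f k))
    rw [← hf]
    exact N.smul_mem (rightColinearEndOfForm R C (f k)) hm
  exact ⟨tmul R (x k) ⟨_, hk⟩, rfl⟩

theorem IsSubcomodule.smul_mem {M : LeftComod R C} {L : Submodule R M.carrier}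
    (hL : M.IsSubcomodule L) (θ : rightColinearEnd R C) {m : M.carrier} (hm : m ∈ L) :
    θ • m ∈ L := by
  obtain ⟨t, ht⟩ := hL m hm
  rw [smul_def, ← ht, sliceLeft_map]
  exact Submodule.coe_mem _

theorem hasClassCover_of_isSimpleModule (hright : IsLocallyProjective Rᵐᵒᵖ C)
    [IsNoetherianRing R] [IsArtinianRing R]
    (h : IsLeftSemiperfectCoring R C) (T : Type u) [AddCommGroup T]
    [Module (rightColinearEnd R C) T] (hT : (leftRationalData hright).IsRational T)
    (hT' : IsSimpleModule (rightColinearEnd R C) T) :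
    HasClassCover (leftRationalData hright).IsRational T := by
  have := full_toModuleCat hright
  have h𝒦 := (leftRationalData hright).isLocallyFiniteClass
  obtain ⟨M, ⟨e⟩⟩ := exists_linearEquiv hright T hT
  have := IsSimpleModule.congr e.symm
  have hM := simple_of_isSimpleModule_obj toModuleCat h𝒦 (isRational hright)
    (exists_linearEquiv hright) M
  obtain ⟨P, f, hP, hf, hsmall⟩ := h M hM
  refine ⟨P.carrier, inferInstance, inferInstance,
    e.symm.toLinearMap ∘ₗ (toModuleCat.map f).hom, P.isRational hright,
    isClassProjective_of_projective toModuleCat (exists_linearEquiv hright) P,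
    e.symm.surjective.comp (surjective_map_of_epi toModuleCat h𝒦 (isRational hright)
    (exists_linearEquiv hright) f), fun L hL => ?_⟩
  have h1 := hsmall (baseSubmodule L) (isSubcomodule_baseSubmodule hright L)
    (eq_top_iff.2 fun x _ => by
      obtain ⟨y, hy, z, hz, rfl⟩ := Submodule.mem_sup.1 (hL ▸ Submodule.mem_top : x ∈ _)
      refine Submodule.add_mem_sup ?_ hz
      exact e.symm.injective ((LinearMap.mem_ker.1 hy).trans (map_zero e.symm).symm))
  exact eq_top_iff.2 fun x _ => (h1 ▸ Submodule.mem_top : x ∈ baseSubmodule L)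

theorem hasProjectiveCover_of_hasClassCover (hright : IsLocallyProjective Rᵐᵒᵖ C)
    [IsNoetherianRing R] [IsArtinianRing R] (M : LeftComod R C)
    (h : HasClassCover (leftRationalData hright).IsRational M.carrier) :
    M.HasProjectiveCover := by
  have := full_toModuleCat hright
  have h𝒦 := (leftRationalData hright).isLocallyFiniteClass
  obtain ⟨X, _, _, f, hX, hXP, hf, hsmall⟩ := h
  obtain ⟨P, ⟨e'⟩⟩ := exists_linearEquiv hright X hX
  let e : X ≃ₗ[rightColinearEnd R C] P.carrier := e'
  let g : P ⟶ M := Hom.ofLinearMap hright (f ∘ₗ e.symm.toLinearMap)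
  refine ⟨P, g, projective_of_isClassProjective toModuleCat h𝒦 (isRational hright)
    (exists_linearEquiv hright) P (hXP.of_linearEquiv e'),
    epi_of_surjective_map toModuleCat g (hf.comp e.symm.surjective), fun L hL hKL => ?_⟩
  let L' : Submodule (rightColinearEnd R C) X :=
    { carrier := {x | e x ∈ L}
      add_mem' := fun {x y} hx hy => by
        change e (x + y) ∈ L
        rw [map_add]; exact L.add_mem hx hy
      zero_mem' := by
        change e 0 ∈ L
        rw [map_zero]; exact L.zero_mem
      smul_mem' := fun θ x hx => by
        change e (θ • x) ∈ L
        rw [map_smul]; exact hL.smul_mem θ hx }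
  have h1 := hsmall L' (eq_top_iff.2 fun x _ => by
    obtain ⟨y, hy, z, hz, hyz⟩ := Submodule.mem_sup.1 (hKL ▸ Submodule.mem_top : e x ∈ _)
    refine Submodule.mem_sup.2 ⟨e.symm y, hy, e.symm z, ?_, ?_⟩
    · change e (e.symm z) ∈ L
      rwa [e.apply_symm_apply]
    · rw [← map_add]
      exact e.symm_apply_eq.2 hyz)
  refine eq_top_iff.2 fun x _ => ?_
  have : e.symm x ∈ L' := h1 ▸ Submodule.mem_top
  have h2 : e (e.symm x) ∈ L := this
  rwa [e.apply_symm_apply] at h2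

end LeftComod

/-! ### Semiperfect implies perfect -/

/-- `θ` is computed by slicing the right factor of `Δ`, while the right colinear `η` acts on the
left factor. -/
theorem leftColinearEnd_smul_comm (θ : leftColinearEnd R C) (η : rightColinearEnd R C) (c : C) :
    θ.1 (η.1 c) = η.1 (θ.1 c) := by
  rw [leftColinearEnd_apply θ (η.1 c), rightColinearEnd_comul, sliceRight_map, LinearMap.comp_id,
    ← leftColinearEnd_apply]

instance : SMulCommClass (leftColinearEnd R C) (rightColinearEnd R C) C :=
  ⟨leftColinearEnd_smul_comm⟩

instance : SMulCommClass (rightColinearEnd R C) (leftColinearEnd R C) C :=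
  ⟨fun η θ c => (leftColinearEnd_smul_comm θ η c).symm⟩

end leftComodules

section main

variable {R C : Type u} [Ring R] [AddCommGroup C] [Module R C] [Module Rᵐᵒᵖ C]
    [SMulCommClass R Rᵐᵒᵖ C] [Coring R C]

/-- Right semiperfectness supplies the covers of simples; left semiperfectness supplies, by duality,
the noetherian injectives that give right comodules maximal subcomodules. -/
theorem isRightPerfectCoring_of_semiperfect (hR : IsQFRing R)
    (hleft : IsLocallyProjective R C) (hright : IsLocallyProjective Rᵐᵒᵖ C)
    (hl : IsLeftSemiperfectCoring R C) (hr : IsRightSemiperfectCoring R C) :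
    IsRightPerfectCoring R C := fun M => by
  have := hR.artinian
  have := hR.isNoetherianRing
  have := hR.isArtinianRing
  have := hR.isNoetherian_op
  have := IsArtinian.isArtinianRing_op (R := R)
  have : IsNoetherianRing Rᵐᵒᵖ := inferInstance
  exact M.hasProjectiveCover_of_hasClassCover hleft
    (RationalData.hasClassCover (D := rightRationalData hleft) (D' := leftRationalData hright)
      hR.injective (fun W _ _ _ => hR.exists_ne_zero_right W) (fun _ => rfl)
      (LeftComod.hasClassCover_of_isSimpleModule hright hl)
      (RightComod.hasClassCover_of_isSimpleModule hleft hr) _ (M.isRational hleft))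

theorem isLeftPerfectCoring_of_semiperfect (hR : IsQFRing R)
    (hleft : IsLocallyProjective R C) (hright : IsLocallyProjective Rᵐᵒᵖ C)
    (hl : IsLeftSemiperfectCoring R C) (hr : IsRightSemiperfectCoring R C) :
    IsLeftPerfectCoring R C := fun M => by
  have := hR.artinian
  have := hR.isNoetherianRing
  have := hR.isArtinianRing
  have := hR.isNoetherian_op
  have := IsArtinian.isArtinianRing_op (R := R)
  have : IsNoetherianRing Rᵐᵒᵖ := inferInstance
  exact M.hasProjectiveCover_of_hasClassCover hright
    (RationalData.hasClassCover (D := leftRationalData hright) (D' := rightRationalData hleft)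
      hR.injective_left (fun W _ _ _ => hR.exists_ne_zero_left W) (fun _ => rfl)
      (RightComod.hasClassCover_of_isSimpleModule hleft hr)
      (LeftComod.hasClassCover_of_isSimpleModule hright hl) _ (M.isRational hright))

end main

theorem proposition4p5 {R C : Type u} [Ring R] [AddCommGroup C] [Module R C] [Module Rᵐᵒᵖ C]
    [SMulCommClass R Rᵐᵒᵖ C] [Coring R C] (hR : IsQFRing R)
    (hleft : IsLocallyProjective R C) (hright : IsLocallyProjective Rᵐᵒᵖ C) :
    (IsLeftPerfectCoring R C ∧ IsRightPerfectCoring R C) ↔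
      (IsLeftSemiperfectCoring R C ∧ IsRightSemiperfectCoring R C) :=
  ⟨fun h => ⟨fun M _ => h.1 M, fun M _ => h.2 M⟩, fun h =>
    ⟨isLeftPerfectCoring_of_semiperfect hR hleft hright h.1 h.2,
      isRightPerfectCoring_of_semiperfect hR hleft hright h.1 h.2⟩⟩
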